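/- Let $H\in(0,1]$ and $\sigma\in\mathbb{R}$, and let $\{B_H(t)\}_{t\in\mathbb{R}}$ be a fractional Brownian motion with Hurst parameter $H$, i.e. an almost surely continuous centred Gaussian process with $\mathbb{E}(B_H(t)B_H(s))=\frac12\left(|t|^{2H}+|s|^{2H}-|t-s|^{2H}\right)$ for $s,t\in\mathbb{R}$. For $\lambda>0$ put $T_\lambda(y)(t)=\int_{-\infty}^t e^{-\lambda(t-s)}\,dy(s)$, a pathwise improper Riemann--Stieltjes integral. For $\alpha,\beta>0$ with $\alpha\neq\beta$, a process $\{X_t\}_{t\in\mathbb{R}}$ is called $\mathrm{FOU}(\alpha,\beta,\sigma,H)$ if, for some such $B_H$, almost surely $X_t=(T_\alpha\circ T_\beta)(\sigma B_H)(t)$ for all $t\in\mathbb{R}$, and it is called $\mathrm{FOU}(\alpha^{(2)},\sigma,H)$ if, for some such $B_H$, almost surely $X_t=(T_\alpha\circ T_\alpha)(\sigma B_H)(t)$ for all $t\in\mathbb{R}$. For $x\ge 0$ let $$f_H(x)=e^{-x}\Big(\Gamma(2H)-\int_0^x e^{s}s^{2H-1}\,ds\Big)+e^{x}\Big(\Gamma(2H)-\int_0^x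 e^{-s}s^{2H-1}\,ds\Big).$$ 1. If $\{X_t\}\sim\mathrm{FOU}(\alpha,\beta,\sigma,H)$ with $\alpha\neq\beta$, then for all $s\in\mathbb{R}$ and $t\ge 0$ the product $X_sX_{s+t}$ is integrable and $$\mathbb{E}(X_sX_{s+t})=\frac{\sigma^2H}{2}\left[\frac{\alpha^{2-2H}f_H(\alpha t)-\beta^{2-2H}f_H(\beta t)}{\alpha^2-\beta^2}\right].$$ 2. If $\{X_t\}\sim\mathrm{FOU}(\alpha^{(2)},\sigma,H)$, then for all $s\in\mathbb{R}$ and $t\ge 0$ the product $X_sX_{s+t}$ is integrable, $f_H$ is differentiable at $\alpha t$ if $t>0$, and $$\mathbb{E}(X_sX_{s+t})=\frac{\sigma^2H}{2\alpha^{2H}}\left[(1-H)f_H(\alpha t)+\frac{\alpha t\,f_H'(\alpha t)}{2}\right],$$ where the term $\alpha t\,f_H'(\alpha t)$ is read as $0$ when $t=0$. In particular (case $s=0$) these are the values of $\mathbb{E}(X_0X_t)$, $t\ge0$. -/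

import Mathlib

open MeasureTheory ProbabilityTheory Filter Topology

/-- `B` is a (two-sided) fractional Brownian motion with Hurst parameter `H ∈ (0, 1]`: an almost
surely continuous centred Gaussian process with the covariance
`E(B_t B_s) = (|t|^{2H} + |s|^{2H} - |t - s|^{2H}) / 2`. -/
structure IsFractionalBrownianMotion {Ω : Type*} [MeasurableSpace Ω]
    (B : ℝ → Ω → ℝ) (H : ℝ) (P : Measure Ω) : Prop where
  hurst_pos : 0 < H
  hurst_le_one : H ≤ 1
  gaussian : IsGaussianProcess B P
  centred : ∀ t, ∫ ω, B t ω ∂P = 0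
  covariance : ∀ t s, ∫ ω, B t ω * B s ω ∂P =
    (|t| ^ (2 * H) + |s| ^ (2 * H) - |t - s| ^ (2 * H)) / 2
  continuous_paths : ∀ᵐ ω ∂P, Continuous fun t => B t ω

/-- `I` is the Riemann–Stieltjes integral `∫_a^b f dy`: `a ≤ b`, and the sums
`∑ f(ξ_i) (y(x_{i+1}) - y(x_i))` over tagged partitions `a = x_0 ≤ ⋯ ≤ x_n = b`,
`ξ_i ∈ [x_i, x_{i+1}]`, converge to `I` as the mesh tends to zero. -/
def HasRSIntegral (f y : ℝ → ℝ) (a b I : ℝ) : Prop :=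
  a ≤ b ∧ ∀ ε > 0, ∃ δ > 0, ∀ (n : ℕ) (x ξ : ℕ → ℝ),
    Monotone x → x 0 = a → x n = b →
    (∀ i < n, x (i + 1) - x i < δ) →
    (∀ i < n, ξ i ∈ Set.Icc (x i) (x (i + 1))) →
    |(∑ i ∈ Finset.range n, f (ξ i) * (y (x (i + 1)) - y (x i))) - I| < ε

/-- `I` is the improper Riemann–Stieltjes integral `∫_{-∞}^t f dy`. -/
def HasImproperRSIntegral (f y : ℝ → ℝ) (t I : ℝ) : Prop :=
  ∃ J : ℝ → ℝ, (∀ a ≤ t, HasRSIntegral f y a t (J a)) ∧ Tendsto J atBot (𝓝 I)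

/-- `T_lam(y)(t)` exists and equals `x`, where
`T_lam(y)(t) = ∫_{-∞}^t exp(-lam (t - s)) dy(s)`. -/
def HasOUValue (lam : ℝ) (y : ℝ → ℝ) (t x : ℝ) : Prop :=
  HasImproperRSIntegral (fun s => Real.exp (-lam * (t - s))) y t x

/-- `(T_{l_1} ∘ ⋯ ∘ T_{l_p})(y)(t)` exists and equals `x`, for the list `[l_1, …, l_p]`. -/
def HasIteratedOUValue : List ℝ → (ℝ → ℝ) → ℝ → ℝ → Prop
  | [], y, t, x => y t = x
  | lam :: l, y, t, x =>
      ∃ z : ℝ → ℝ, (∀ s, HasIteratedOUValue l y s (z s)) ∧ HasOUValue lam z t x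

/-- `X ∼ FOU(lam_1^{(p_1)}, …, lam_q^{(p_q)}, σ, H)`, the parameters being given by the list
`L = [(lam_1, p_1), …, (lam_q, p_q)]` of distinct positive numbers with multiplicities `p_i ≥ 1`:
there is a fractional Brownian motion `B` with Hurst parameter `H` such that almost surely
`X_t = (T_{lam_1}^{p_1} ∘ ⋯ ∘ T_{lam_q}^{p_q})(σ B)(t)` for all real `t`. -/
structure IsFOU {Ω : Type*} [MeasurableSpace Ω]
    (X : ℝ → Ω → ℝ) (L : List (ℝ × ℕ)) (σ H : ℝ) (P : Measure Ω) : Prop where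
  pos : ∀ c ∈ L, 0 < c.1
  mult_pos : ∀ c ∈ L, 1 ≤ c.2
  distinct : (L.map Prod.fst).Nodup
  exists_fbm : ∃ B : ℝ → Ω → ℝ, IsFractionalBrownianMotion B H P ∧
    ∀ᵐ ω ∂P, ∀ t, HasIteratedOUValue (L.flatMap fun c => List.replicate c.2 c.1)
      (fun s => σ * B s ω) t (X t ω)

/-- The function
`f_H(x) = e^{-x} (Γ(2H) - ∫_0^x e^s s^{2H-1} ds) + e^x (Γ(2H) - ∫_0^x e^{-s} s^{2H-1} ds)`
(used for `x ≥ 0`). -/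
noncomputable def fH (H x : ℝ) : ℝ :=
  Real.exp (-x) * (Real.Gamma (2 * H) - ∫ s in (0 : ℝ)..x, Real.exp s * s ^ (2 * H - 1)) +
  Real.exp x * (Real.Gamma (2 * H) - ∫ s in (0 : ℝ)..x, Real.exp (-s) * s ^ (2 * H - 1))

/-! The argument turns the process into a moving average of increments of the noise and computes a
covariance integral.

Pathwise, integration by parts gives `T_lam y (t) = y t - lam ∫_{-∞}^t exp(-lam (t - s)) y s ds`.
The boundary term at `-∞` needs no growth bound on paths: it has a limit because every other term
converges, and an integrable function can only have limit `0`. The integrability of `exp(γ s) B_s`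
on the negative half-line holds almost surely by Fubini. Composing twice yields `X_t = ∫_0^∞ h(u) (y
t - y (t - u)) du` with `y = σ B` and a kernel `h` of total mass one, a combination of `exp(-α u)`
and `exp(-β u)`, or of `exp(-α u)` and `u exp(-α u)` when the rates coincide
(`HasIteratedOUValue.eq_integral_of_ne`, `HasIteratedOUValue.eq_integral_of_eq`).

Fubini then writes the second moment as a double integral of `h(u) h(v)` against the covariance of
increments. Mass one collapses the terms depending on one variable, and the remaining term depends
only on `u - v`, so it sees `h` only through its autocorrelation `ρ`. What is left is `σ² / 2` times
`∫ (h - ρ)(w) (|t - w|^{2H} + |t + w|^{2H}) dw - |t|^{2H}`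
(`IsFractionalBrownianMotion.movingAverage_secondMoment`).

Both `h` and `ρ` are exponentials, possibly times `w`, so a Laplace transform is all that is needed,
and `fH` is exactly its nontrivial part (`integral_exp_neg_mul_mul_abs_rpow`). For the double rate
the factor `w` comes from differentiating in the rate, which produces the derivative of `fH`. In
both cases the powers `t^{2H}` cancel. -/

/-! ### Pathwise integrals and the composition of two Ornstein–Uhlenbeck operators -/

/-- Integration by parts for the Riemann–Stieltjes integral of a `C¹` function against a
continuous one. -/
theorem HasRSIntegral.eq_sub_integral {f f' y : ℝ → ℝ} {a b I : ℝ}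
    (h : HasRSIntegral f y a b I) (hf : ∀ s, HasDerivAt f (f' s) s) (hf' : Continuous f')
    (hy : Continuous y) :
    I = f b * y b - f a * y a - ∫ s in a..b, f' s * y s := by
  obtain ⟨hab, h⟩ := h
  obtain ⟨M, hM⟩ := (isCompact_Icc (a := a) (b := b)).exists_bound_of_continuousOn
    hf'.continuousOn
  have hM0 : 0 ≤ M := (norm_nonneg _).trans (hM a ⟨le_rfl, hab⟩)
  have huc := (isCompact_Icc (a := a) (b := b)).uniformContinuousOn_of_continuous hy.continuousOn
  rw [Metric.uniformContinuousOn_iff] at huc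
  refine eq_of_abs_sub_nonpos (le_of_forall_pos_le_add fun ε hε => ?_)
  rw [zero_add]
  obtain ⟨δ₁, hδ₁, h₁⟩ := h (ε / 2) (by positivity)
  -- Chosen so that `M * (b - a) * η ≤ ε / 2`; the `+ 1` covers `M * (b - a) = 0`.
  set η := ε / (2 * (M * (b - a) + 1)) with hη
  have hden : 0 < M * (b - a) + 1 := by
    have := mul_nonneg hM0 (sub_nonneg.2 hab)
    linarith
  have hη0 : 0 < η := by positivity
  obtain ⟨δ₂, hδ₂, h₂⟩ := huc η hη0
  obtain ⟨m, hm⟩ := exists_nat_gt ((b - a) / min δ₁ δ₂)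
  have hmin : 0 < min δ₁ δ₂ := lt_min hδ₁ hδ₂
  have hm0 : (0 : ℝ) < m := lt_of_le_of_lt (div_nonneg (sub_nonneg.2 hab) hmin.le) hm
  set d := (b - a) / m with hd
  have hd0 : 0 ≤ d := div_nonneg (sub_nonneg.2 hab) hm0.le
  have hdm : m * d = b - a := by rw [hd]; field_simp
  have hdlt : d < min δ₁ δ₂ := by
    rw [hd, div_lt_iff₀ hm0]
    rwa [div_lt_iff₀ hmin, mul_comm] at hm
  set x : ℕ → ℝ := fun i => a + i * d with hx
  have hstep : ∀ i, x (i + 1) - x i = d := fun i => by simp only [hx]; push_cast; ring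
  have hmono : Monotone x := monotone_nat_of_le_succ fun i => by linarith [hstep i]
  have hx0 : x 0 = a := by simp [hx]
  have hxm : x m = b := by simp only [hx]; linarith
  -- Right-endpoint tags: Abel summation then leaves increments of `f` weighted by `y` at left
  -- endpoints.
  have key := h₁ m x (fun i => x (i + 1)) hmono hx0 hxm
    (fun i _ => by rw [hstep]; exact hdlt.trans_le (min_le_left _ _))
    (fun i _ => ⟨hmono (Nat.le_succ i), le_rfl⟩)
  have hcont : ∀ c d : ℝ, IntervalIntegrable (fun s => f' s * y s) volume c d :=
    fun c d => (hf'.mul hy).intervalIntegrable _ _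
  have hsplit : ∑ i ∈ Finset.range m, (∫ s in x i..x (i + 1), f' s * y s)
      = ∫ s in a..b, f' s * y s := by
    rw [intervalIntegral.sum_integral_adjacent_intervals (fun i _ => hcont _ _), hx0, hxm]
  have htel : ∑ i ∈ Finset.range m, (f (x (i + 1)) * y (x (i + 1)) - f (x i) * y (x i))
      = f b * y b - f a * y a := by
    rw [Finset.sum_range_sub (fun i => f (x i) * y (x i)), hx0, hxm]
  have hterm : ∀ i ∈ Finset.range m,
      |(∫ s in x i..x (i + 1), f' s * y s) - (f (x (i + 1)) - f (x i)) * y (x i)|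
        ≤ η * M * d := by
    intro i hi
    have hi' : i + 1 ≤ m := Finset.mem_range.1 hi
    have e1 : f (x (i + 1)) - f (x i) = ∫ s in x i..x (i + 1), f' s :=
      (intervalIntegral.integral_eq_sub_of_hasDerivAt (fun s _ => hf s)
        (hf'.intervalIntegrable _ _)).symm
    rw [e1, ← intervalIntegral.integral_mul_const, ← intervalIntegral.integral_sub (hcont _ _)
      ((by fun_prop : Continuous fun s => f' s * y (x i)).intervalIntegrable _ _)]
    have hb := intervalIntegral.norm_integral_le_of_norm_le_const (a := x i) (b := x (i + 1))
      (f := fun s => f' s * y s - f' s * y (x i)) (C := η * M) ?_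
    · rwa [hstep, abs_of_nonneg hd0] at hb
    · intro s hs
      rw [Set.uIoc_of_le (hmono (Nat.le_succ i))] at hs
      have hxi : a ≤ x i := hx0 ▸ hmono (Nat.zero_le i)
      have hxi1 : x (i + 1) ≤ b := hxm ▸ hmono hi'
      have hsm : s ∈ Set.Icc a b := ⟨by linarith [hs.1], by linarith [hs.2]⟩
      have hdist := h₂ s hsm (x i) ⟨hxi, by linarith [hmono (Nat.le_succ i)]⟩ (by
        rw [Real.dist_eq, abs_of_pos (by linarith [hs.1])]
        have := hstep i
        have := min_le_right δ₁ δ₂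
        linarith [hs.2])
      rw [Real.dist_eq] at hdist
      rw [← mul_sub, norm_mul, Real.norm_eq_abs (y s - _), mul_comm]
      exact mul_le_mul hdist.le (hM s hsm) (norm_nonneg _) hη0.le
  have hsum : |(∫ s in a..b, f' s * y s)
      - ∑ i ∈ Finset.range m, (f (x (i + 1)) - f (x i)) * y (x i)| ≤ ε / 2 := by
    rw [← hsplit, ← Finset.sum_sub_distrib]
    refine (Finset.abs_sum_le_sum_abs _ _).trans ((Finset.sum_le_sum hterm).trans ?_)
    rw [Finset.sum_const, Finset.card_range, nsmul_eq_mul]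
    have : (m : ℝ) * (η * M * d) = η * (M * (b - a)) := by rw [← hdm]; ring
    rw [this, hη, div_mul_eq_mul_div, div_le_div_iff₀ (by positivity) two_pos]
    nlinarith
  have habel : ∑ i ∈ Finset.range m, f (x (i + 1)) * (y (x (i + 1)) - y (x i))
      = f b * y b - f a * y a - ∑ i ∈ Finset.range m, (f (x (i + 1)) - f (x i)) * y (x i) := by
    rw [← htel, ← Finset.sum_sub_distrib]
    exact Finset.sum_congr rfl fun i _ => by ring
  rw [habel] at key
  rw [abs_le] at hsum ⊢
  rw [abs_lt] at key
  constructor <;> linarith [key.1, key.2, hsum.1, hsum.2]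

/-- For a continuous integrator, the value of `T_lam` is a limit of ordinary integrals. -/
theorem HasOUValue.tendsto {lam : ℝ} {y : ℝ → ℝ} {t x : ℝ} (h : HasOUValue lam y t x)
    (hy : Continuous y) :
    Tendsto (fun a => y t - Real.exp (-lam * t) * (Real.exp (lam * a) * y a)
      - lam * Real.exp (-lam * t) * ∫ s in a..t, Real.exp (lam * s) * y s) atBot (𝓝 x) := by
  obtain ⟨J, hJ, hlim⟩ := h
  refine hlim.congr' ?_
  filter_upwards [eventually_le_atBot t] with a ha
  have hd : ∀ s, HasDerivAt (fun s => Real.exp (-lam * (t - s)))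
      (lam * Real.exp (-lam * t) * Real.exp (lam * s)) s := by
    intro s
    have h1 : HasDerivAt (fun s => -lam * (t - s)) (-lam * -1) s :=
      ((hasDerivAt_id s).const_sub t).const_mul (-lam)
    convert h1.exp using 1
    rw [mul_assoc, ← Real.exp_add]
    have : -lam * (t - s) = -lam * t + lam * s := by ring
    rw [this]; ring
  rw [(hJ a ha).eq_sub_integral hd (by fun_prop) hy]
  have e : ∀ s, lam * Real.exp (-lam * t) * Real.exp (lam * s) * y s
      = lam * Real.exp (-lam * t) * (Real.exp (lam * s) * y s) := fun s => by ring
  simp only [e, intervalIntegral.integral_const_mul, sub_self, mul_zero, Real.exp_zero, one_mul]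
  rw [← mul_assoc (Real.exp (-lam * t)), ← Real.exp_add]
  ring_nf

/-- A function which is integrable at `-∞` can only have the limit `0` there. -/
theorem eq_zero_of_integrableOn_Iic_of_tendsto {f : ℝ → ℝ} {t c : ℝ}
    (hf : IntegrableOn f (Set.Iic t)) (h : Tendsto f atBot (𝓝 c)) : c = 0 := by
  refine IntegrableAtFilter.eq_zero_of_tendsto (μ := volume) (l := atBot)
    ⟨Set.Iic t, Iic_mem_atBot t, hf⟩ (fun s hs => ?_) h
  obtain ⟨a, ha⟩ := mem_atBot_sets.1 hs
  rw [eq_top_iff, ← Real.volume_Iic (a := a)]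
  exact measure_mono fun b hb => ha b hb

/-- The boundary term `exp(lam a) y a` converges because it is a combination of convergent
quantities; being integrable, it tends to `0`. -/
theorem HasOUValue.eq_of_integrableOn {lam : ℝ} {y : ℝ → ℝ} {t x : ℝ} (h : HasOUValue lam y t x)
    (hy : Continuous y) (hint : IntegrableOn (fun s => Real.exp (lam * s) * y s) (Set.Iic t)) :
    x = y t - lam * Real.exp (-lam * t) * ∫ s in Set.Iic t, Real.exp (lam * s) * y s := by
  have h1 := h.tendsto hy
  have h2 := (intervalIntegral_tendsto_integral_Iic t hint tendsto_id).const_mul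
    (lam * Real.exp (-lam * t))
  have h3 := ((h1.add h2).const_sub (y t)).const_mul (Real.exp (lam * t))
  have h4 : Tendsto (fun s => Real.exp (lam * s) * y s) atBot (𝓝 (Real.exp (lam * t) *
      (y t - (x + lam * Real.exp (-lam * t) *
        ∫ s in Set.Iic t, Real.exp (lam * s) * y s)))) := by
    refine h3.congr fun a => ?_
    have : Real.exp (lam * t) * Real.exp (-lam * t) = 1 := by
      rw [← Real.exp_add]; simp
    simp only [id]
    linear_combination (Real.exp (lam * a) * y a) * this
  have h5 := eq_zero_of_integrableOn_Iic_of_tendsto hint h4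
  have h6 := (mul_eq_zero.1 h5).resolve_left (Real.exp_pos _).ne'
  linarith

theorem integrableOn_exp_mul_Iic_of_le {γ lam : ℝ} (hle : γ ≤ lam) {y : ℝ → ℝ}
    (hy : Continuous y) (hint : IntegrableOn (fun s => Real.exp (γ * s) * y s) (Set.Iic 0))
    (t : ℝ) : IntegrableOn (fun s => Real.exp (lam * s) * y s) (Set.Iic t) := by
  have hc : Continuous fun s => Real.exp (lam * s) * y s := by fun_prop
  have h0 : IntegrableOn (fun s => Real.exp (lam * s) * y s) (Set.Iic 0) := by
    refine Integrable.mono hint hc.aestronglyMeasurable ?_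
    filter_upwards [ae_restrict_mem measurableSet_Iic] with s hs
    rw [norm_mul, norm_mul]
    refine mul_le_mul_of_nonneg_right ?_ (norm_nonneg _)
    rw [Real.norm_eq_abs, Real.norm_eq_abs, Real.abs_exp, Real.abs_exp, Real.exp_le_exp]
    exact mul_le_mul_of_nonpos_right hle hs
  refine (h0.union (hc.integrableOn_Icc (a := 0) (b := t))).mono_set fun s hs => ?_
  rcases le_total s 0 with h | h
  · exact Or.inl h
  · exact Or.inr ⟨h, hs⟩

theorem hasDerivAt_setIntegral_Iic {f : ℝ → ℝ} (hf : Continuous f)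
    (hint : ∀ t, IntegrableOn f (Set.Iic t)) (t : ℝ) :
    HasDerivAt (fun t => ∫ s in Set.Iic t, f s) (f t) t := by
  have h1 : ∀ u, ∫ s in Set.Iic u, f s = (∫ s in Set.Iic t, f s) + ∫ s in t..u, f s := by
    intro u
    rw [← intervalIntegral.integral_Iic_sub_Iic (hint t) (hint u)]; ring
  rw [funext h1]
  exact (intervalIntegral.integral_hasDerivAt_right (hf.intervalIntegrable _ _)
    (hf.stronglyMeasurableAtFilter _ _) hf.continuousAt).const_add _

/-- For `s ≤ t` one has `exp(lam s) ≤ exp((lam - γ) t) exp(γ s)`: the spare exponent becomes decay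
in `t`. -/
theorem abs_setIntegral_Iic_exp_mul_le {γ lam : ℝ} (hle : γ ≤ lam) {y : ℝ → ℝ}
    (hint : IntegrableOn (fun s => Real.exp (γ * s) * y s) (Set.Iic 0))
    {t : ℝ} (ht : t ≤ 0) :
    |∫ s in Set.Iic t, Real.exp (lam * s) * y s| ≤
      Real.exp ((lam - γ) * t) * ∫ s in Set.Iic 0, |Real.exp (γ * s) * y s| := by
  have hn : IntegrableOn (fun s => |Real.exp (γ * s) * y s|) (Set.Iic 0) := hint.abs
  calc |∫ s in Set.Iic t, Real.exp (lam * s) * y s|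
      ≤ ∫ s in Set.Iic t, Real.exp ((lam - γ) * t) * |Real.exp (γ * s) * y s| := by
        have hb : IntegrableOn (fun s => Real.exp ((lam - γ) * t) * |Real.exp (γ * s) * y s|)
            (Set.Iic t) := Integrable.const_mul (hn.mono_set (Set.Iic_subset_Iic.2 ht)) _
        rw [← Real.norm_eq_abs]
        refine norm_integral_le_of_norm_le hb ?_
        filter_upwards [ae_restrict_mem measurableSet_Iic] with s hs
        rw [Real.norm_eq_abs, abs_mul, abs_mul, Real.abs_exp, Real.abs_exp, ← mul_assoc,
          ← Real.exp_add]
        refine mul_le_mul_of_nonneg_right (Real.exp_le_exp.2 ?_) (abs_nonneg _)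
        have := mul_le_mul_of_nonneg_left (Set.mem_Iic.1 hs) (sub_nonneg.2 hle)
        linarith
    _ = Real.exp ((lam - γ) * t) * ∫ s in Set.Iic t, |Real.exp (γ * s) * y s| :=
        integral_const_mul _ _
    _ ≤ _ := by
        refine mul_le_mul_of_nonneg_left ?_ (Real.exp_pos _).le
        exact setIntegral_mono_set hn (ae_of_all _ fun _ => abs_nonneg _)
          (Set.Iic_subset_Iic.2 ht).eventuallyLE

theorem tendsto_exp_mul_const_atBot {c : ℝ} (hc : 0 < c) (K : ℝ) :
    Tendsto (fun s => Real.exp (c * s) * K) atBot (𝓝 0) := by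
  simpa using (Real.tendsto_exp_atBot.comp (tendsto_id.const_mul_atBot hc)).mul_const K

/-- The decay rate `lam - γ` of the integral absorbs a prefactor that may itself blow up (`c < 0`),
as long as the total exponent stays positive. -/
theorem tendsto_exp_mul_setIntegral_Iic {c γ lam : ℝ} (hle : γ ≤ lam) (hc : 0 < c + lam - γ)
    {y : ℝ → ℝ} (hint : IntegrableOn (fun s => Real.exp (γ * s) * y s) (Set.Iic 0)) :
    Tendsto (fun s => Real.exp (c * s) * ∫ r in Set.Iic s, Real.exp (lam * r) * y r)
      atBot (𝓝 0) := by
  refine squeeze_zero_norm' ?_ (tendsto_exp_mul_const_atBot hc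
    (∫ r in Set.Iic 0, |Real.exp (γ * r) * y r|))
  filter_upwards [eventually_le_atBot 0] with s hs
  rw [Real.norm_eq_abs, abs_mul, Real.abs_exp]
  refine (mul_le_mul_of_nonneg_left (abs_setIntegral_Iic_exp_mul_le hle hint hs)
    (Real.exp_pos _).le).trans_eq ?_
  rw [← mul_assoc, ← Real.exp_add]
  ring_nf

/-- Two-fold composition `T_α ∘ T_β`, in terms of an antiderivative `V` vanishing at `-∞`. -/
theorem HasIteratedOUValue.eq_of_hasDerivAt {α β γ : ℝ} (hα : γ < α) (hβ : γ < β) {y : ℝ → ℝ}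
    (hy : Continuous y) (hint : IntegrableOn (fun s => Real.exp (γ * s) * y s) (Set.Iic 0))
    {V : ℝ → ℝ}
    (hV : ∀ s, HasDerivAt V
      (Real.exp ((α - β) * s) * ∫ r in Set.Iic s, Real.exp (β * r) * y r) s)
    (hV0 : Tendsto V atBot (𝓝 0)) {t x : ℝ} (h : HasIteratedOUValue [α, β] y t x) :
    x = y t - (α + β) * (Real.exp (-β * t) * ∫ r in Set.Iic t, Real.exp (β * r) * y r)
      + α ^ 2 * (Real.exp (-α * t) * V t) := by
  obtain ⟨z, hz, hx⟩ := h
  have hiβ := integrableOn_exp_mul_Iic_of_le hβ.le hy hint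
  have hiα := integrableOn_exp_mul_Iic_of_le hα.le hy hint
  set E : ℝ → ℝ := fun s => ∫ r in Set.Iic s, Real.exp (β * r) * y r with hE
  have hEd : ∀ s, HasDerivAt E (Real.exp (β * s) * y s) s :=
    hasDerivAt_setIntegral_Iic (by fun_prop) hiβ
  have hEc : Continuous E := continuous_iff_continuousAt.2 fun s => (hEd s).continuousAt
  have hz' : ∀ s, z s = y s - β * Real.exp (-β * s) * E s := by
    intro s
    obtain ⟨w, hw, hws⟩ := hz s
    have hwy : w = y := funext fun r => (hw r).symm
    rw [hwy] at hws
    exact hws.eq_of_integrableOn hy (hiβ s)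
  have hzc : Continuous z := by
    rw [funext hz']
    fun_prop
  have hexp : ∀ s, Real.exp (α * s) * Real.exp (-β * s) = Real.exp ((α - β) * s) := fun s => by
    rw [← Real.exp_add]; ring_nf
  -- An antiderivative of `exp(α s) z s`: by the product rule that function is the derivative of
  -- `exp((α - β) s) E s` minus `α exp((α - β) s) E s`, and `V` integrates the latter.
  set U : ℝ → ℝ := fun s => Real.exp ((α - β) * s) * E s - α * V s with hU
  have hUd : ∀ s, HasDerivAt U (Real.exp (α * s) * z s) s := by
    intro s
    have h1 : HasDerivAt (fun s : ℝ => Real.exp ((α - β) * s))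
        (Real.exp ((α - β) * s) * ((α - β) * 1)) s :=
      ((hasDerivAt_id s).const_mul (α - β)).exp
    refine ((h1.mul (hEd s)).sub ((hV s).const_mul α)).congr_deriv ?_
    have h2 : Real.exp ((α - β) * s) * Real.exp (β * s) = Real.exp (α * s) := by
      rw [← Real.exp_add]; ring_nf
    rw [hz']
    linear_combination (β * E s) * hexp s + y s * h2
  have hE0 : Tendsto (fun s => Real.exp ((α - β) * s) * E s) atBot (𝓝 0) :=
    tendsto_exp_mul_setIntegral_Iic hβ.le (by linarith) hint
  have hU0 : Tendsto U atBot (𝓝 0) := by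
    simpa using hE0.sub (hV0.const_mul α)
  have hUint : ∀ a, ∫ s in a..t, Real.exp (α * s) * z s = U t - U a := fun a =>
    intervalIntegral.integral_eq_sub_of_hasDerivAt (fun s _ => hUd s)
      ((by fun_prop : Continuous fun s => Real.exp (α * s) * z s).intervalIntegrable _ _)
  have h1 := hx.tendsto hzc
  simp only [hUint] at h1
  have h2 := (hU0.const_sub (U t)).const_mul (α * Real.exp (-α * t))
  have h3 := ((h1.add h2).const_sub (z t)).const_mul (Real.exp (α * t))
  -- The boundary term is `exp(α a) z a`. Adding a multiple of the null term `exp((α - β) a) E a`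
  -- turns it into `exp(α a) y a`, whose integrability is already known.
  have h4 := h3.add (hE0.const_mul β)
  have h5 : Tendsto (fun s => Real.exp (α * s) * y s) atBot
      (𝓝 (Real.exp (α * t) * (z t - (x + α * Real.exp (-α * t) * (U t - 0))) + β * 0)) := by
    refine h4.congr fun a => ?_
    have : Real.exp (α * t) * Real.exp (-α * t) = 1 := by
      rw [← Real.exp_add]; simp
    rw [hz' a]
    linear_combination (Real.exp (α * a) * (y a - β * Real.exp (-β * a) * E a)) * this
      - β * E a * hexp a
  have h6 := eq_zero_of_integrableOn_Iic_of_tendsto (hiα 0) h5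
  rw [mul_zero, add_zero, sub_zero] at h6
  have h7 := (mul_eq_zero.1 h6).resolve_left (Real.exp_pos _).ne'
  have h8 : Real.exp (-α * t) * Real.exp ((α - β) * t) = Real.exp (-β * t) := by
    rw [← Real.exp_add]; ring_nf
  rw [hz' t] at h7
  simp only [hU] at h7
  linear_combination -h7 - α * E t * h8

/-! ### Moving-average kernels -/

theorem integral_Iic_eq_integral_Ioi_sub (F : ℝ → ℝ) (t : ℝ) :
    ∫ r in Set.Iic t, F r = ∫ u in Set.Ioi (0 : ℝ), F (t - u) := by
  have h := (Measure.measurePreserving_sub_left volume t).setIntegral_preimage_emb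
    (MeasurableEquiv.subLeft t).measurableEmbedding F (Set.Iio t)
  have hp : (fun u => t - u) ⁻¹' Set.Iio t = Set.Ioi 0 := by
    ext u; simp
  rw [hp] at h
  rw [integral_Iic_eq_integral_Iio, h]

theorem integrableOn_Ioi_sub_iff {F : ℝ → ℝ} {t : ℝ} :
    IntegrableOn (fun u => F (t - u)) (Set.Ioi 0) ↔ IntegrableOn F (Set.Iic t) := by
  have h := (Measure.measurePreserving_sub_left volume t).integrableOn_comp_preimage
    (MeasurableEquiv.subLeft t).measurableEmbedding (f := F) (s := Set.Iio t)
  have hp : (fun u => t - u) ⁻¹' Set.Iio t = Set.Ioi 0 := by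
    ext u; simp
  rw [hp] at h
  rw [integrableOn_Iic_iff_integrableOn_Iio, ← h]
  rfl

theorem integral_pow_mul_exp_neg_mul_Ioi {lam : ℝ} (hlam : 0 < lam) (n : ℕ) :
    ∫ u in Set.Ioi (0 : ℝ), u ^ n * Real.exp (-lam * u) = n.factorial / lam ^ (n + 1) := by
  have h := Real.integral_rpow_mul_exp_neg_mul_Ioi (a := n + 1) (r := lam) (by positivity) hlam
  simp only [add_sub_cancel_right, Real.rpow_natCast, Real.Gamma_nat_eq_factorial] at h
  simp only [neg_mul]
  rw [h]
  have : ((n : ℝ) + 1) = ((n + 1 : ℕ) : ℝ) := by push_cast; rfl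
  rw [this, Real.rpow_natCast, one_div, inv_pow]
  ring

theorem integrableOn_pow_mul_exp_neg_mul_Ioi {lam : ℝ} (hlam : 0 < lam) (n : ℕ) :
    IntegrableOn (fun u => u ^ n * Real.exp (-lam * u)) (Set.Ioi 0) := by
  -- A non-integrable function has integral `0` by convention, whereas the computed value is
  -- positive.
  by_contra h
  have h1 := integral_undef h
  rw [integral_pow_mul_exp_neg_mul_Ioi hlam n] at h1
  have : (0 : ℝ) < n.factorial / lam ^ (n + 1) := by positivity
  exact this.ne' h1

theorem integral_exp_neg_mul_Ioi_zero {lam : ℝ} (hlam : 0 < lam) :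
    ∫ u in Set.Ioi (0 : ℝ), Real.exp (-lam * u) = 1 / lam := by
  simpa using integral_pow_mul_exp_neg_mul_Ioi hlam 0

theorem integrableOn_exp_neg_mul_Ioi_zero {lam : ℝ} (hlam : 0 < lam) :
    IntegrableOn (fun u => Real.exp (-lam * u)) (Set.Ioi 0) := by
  simpa using integrableOn_pow_mul_exp_neg_mul_Ioi hlam 0

theorem exp_neg_mul_mul_exp_mul_sub (lam t u : ℝ) :
    Real.exp (-lam * t) * Real.exp (lam * (t - u)) = Real.exp (-lam * u) := by
  rw [← Real.exp_add]; ring_nf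

theorem exp_neg_mul_integral_Iic (lam : ℝ) (y : ℝ → ℝ) (t : ℝ) :
    Real.exp (-lam * t) * ∫ r in Set.Iic t, Real.exp (lam * r) * y r
      = ∫ u in Set.Ioi (0 : ℝ), Real.exp (-lam * u) * y (t - u) := by
  rw [integral_Iic_eq_integral_Ioi_sub, ← integral_const_mul]
  simp only [← mul_assoc, exp_neg_mul_mul_exp_mul_sub]

theorem integrableOn_exp_neg_mul_comp_sub {lam : ℝ} {y : ℝ → ℝ} {t : ℝ}
    (h : IntegrableOn (fun s => Real.exp (lam * s) * y s) (Set.Iic t)) :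
    IntegrableOn (fun u => Real.exp (-lam * u) * y (t - u)) (Set.Ioi 0) := by
  have h1 : IntegrableOn (fun u => Real.exp (-lam * t) * (Real.exp (lam * (t - u)) * y (t - u)))
      (Set.Ioi 0) := (integrableOn_Ioi_sub_iff.2 h).const_mul _
  simpa only [← mul_assoc, exp_neg_mul_mul_exp_mul_sub] using h1

theorem abs_le_exp_neg_mul_div {c s : ℝ} (hc : 0 < c) (hs : s ≤ 0) :
    |s| ≤ Real.exp (-c * s) / c := by
  rw [abs_of_nonpos hs, le_div_iff₀ hc]
  linarith [Real.add_one_le_exp (-c * s)]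

/-- The factor `s` is paid for by the gap in exponents, since `|s| ≤ exp(-(γ' - γ) s) / (γ' - γ)`
for `s ≤ 0`. -/
theorem integrableOn_exp_mul_self_mul {γ γ' : ℝ} (hlt : γ < γ') {y : ℝ → ℝ} (hy : Continuous y)
    (hint : IntegrableOn (fun s => Real.exp (γ * s) * y s) (Set.Iic 0)) :
    IntegrableOn (fun s => Real.exp (γ' * s) * (s * y s)) (Set.Iic 0) := by
  refine Integrable.mono (g := fun s => 1 / (γ' - γ) * (Real.exp (γ * s) * y s))
    (hint.const_mul _) (by fun_prop : Continuous _).aestronglyMeasurable ?_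
  filter_upwards [ae_restrict_mem measurableSet_Iic] with s hs
  have hc := sub_pos.2 hlt
  simp only [norm_mul, Real.norm_eq_abs, Real.abs_exp]
  have h1 := abs_le_exp_neg_mul_div hc hs
  have h2 : Real.exp (γ' * s) * Real.exp (-(γ' - γ) * s) = Real.exp (γ * s) := by
    rw [← Real.exp_add]; ring_nf
  rw [abs_of_pos (by positivity : 0 < 1 / (γ' - γ)), ← h2]
  calc Real.exp (γ' * s) * (|s| * |y s|)
      ≤ Real.exp (γ' * s) * (Real.exp (-(γ' - γ) * s) / (γ' - γ) * |y s|) := by gcongr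
    _ = _ := by ring

theorem integral_mul_sub_comp_sub {h y : ℝ → ℝ} {t : ℝ} (hh : IntegrableOn h (Set.Ioi 0))
    (h1 : ∫ u in Set.Ioi (0 : ℝ), h u = 1)
    (hhy : IntegrableOn (fun u => h u * y (t - u)) (Set.Ioi 0)) :
    ∫ u in Set.Ioi (0 : ℝ), h u * (y t - y (t - u))
      = y t - ∫ u in Set.Ioi (0 : ℝ), h u * y (t - u) := by
  simp only [mul_sub]
  rw [integral_sub (hh.mul_const _) hhy, integral_mul_const, h1, one_mul]

theorem integrableOn_kernel_of_ne {α β : ℝ} (hα : 0 < α) (hβ : 0 < β) :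
    IntegrableOn (fun u => (α ^ 2 * Real.exp (-α * u) - β ^ 2 * Real.exp (-β * u)) / (α - β))
      (Set.Ioi 0) :=
  Integrable.div_const (((integrableOn_exp_neg_mul_Ioi_zero hα).const_mul _).sub
    ((integrableOn_exp_neg_mul_Ioi_zero hβ).const_mul _)) _

theorem integrableOn_kernel_of_eq {α : ℝ} (hα : 0 < α) :
    IntegrableOn (fun u => 2 * α * Real.exp (-α * u) - α ^ 2 * (u * Real.exp (-α * u)))
      (Set.Ioi 0) := by
  have i1 := integrableOn_pow_mul_exp_neg_mul_Ioi hα 1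
  simp only [pow_one] at i1
  exact ((integrableOn_exp_neg_mul_Ioi_zero hα).const_mul _).sub (i1.const_mul _)

/-- The kernel is `-g'` with `g u = (α exp(-α u) - β exp(-β u)) / (α - β)`, the weight of `T_α ∘
T_β` against `dy`, and `g 0 = 1`. Mass one is what allows `y t` to be absorbed into an increment. -/
theorem integral_kernel_of_ne {α β : ℝ} (hα : 0 < α) (hβ : 0 < β) (hne : α ≠ β) :
    ∫ u in Set.Ioi (0 : ℝ), (α ^ 2 * Real.exp (-α * u) - β ^ 2 * Real.exp (-β * u)) / (α - β)
      = 1 := by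
  rw [integral_div, integral_sub ((integrableOn_exp_neg_mul_Ioi_zero hα).const_mul _)
    ((integrableOn_exp_neg_mul_Ioi_zero hβ).const_mul _), integral_const_mul, integral_const_mul,
    integral_exp_neg_mul_Ioi_zero hα, integral_exp_neg_mul_Ioi_zero hβ]
  have := sub_ne_zero.2 hne
  field_simp

theorem integral_kernel_of_eq {α : ℝ} (hα : 0 < α) :
    ∫ u in Set.Ioi (0 : ℝ), (2 * α * Real.exp (-α * u) - α ^ 2 * (u * Real.exp (-α * u)))
      = 1 := by
  have i1 := integrableOn_pow_mul_exp_neg_mul_Ioi hα 1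
  have e1 := integral_pow_mul_exp_neg_mul_Ioi hα 1
  simp only [pow_one] at i1 e1
  rw [integral_sub ((integrableOn_exp_neg_mul_Ioi_zero hα).const_mul _) (i1.const_mul _),
    integral_const_mul, integral_const_mul, integral_exp_neg_mul_Ioi_zero hα, e1]
  simp
  field_simp
  norm_num

/-- `T_α ∘ T_β` with `α ≠ β` as a moving average of increments. -/
theorem HasIteratedOUValue.eq_integral_of_ne {α β γ : ℝ} (hγ : 0 < γ) (hα : γ < α) (hβ : γ < β)
    (hne : α ≠ β) {y : ℝ → ℝ} (hy : Continuous y)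
    (hint : IntegrableOn (fun s => Real.exp (γ * s) * y s) (Set.Iic 0))
    {t x : ℝ} (h : HasIteratedOUValue [α, β] y t x) :
    x = ∫ u in Set.Ioi (0 : ℝ),
      (α ^ 2 * Real.exp (-α * u) - β ^ 2 * Real.exp (-β * u)) / (α - β) * (y t - y (t - u)) := by
  have hα0 := hγ.trans hα
  have hβ0 := hγ.trans hβ
  have hiβ := integrableOn_exp_mul_Iic_of_le hβ.le hy hint
  have hiα := integrableOn_exp_mul_Iic_of_le hα.le hy hint
  have hs : β - α ≠ 0 := sub_ne_zero.2 hne.symm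
  have hs' : α - β ≠ 0 := sub_ne_zero.2 hne
  -- Integration by parts of `exp((α - β) s)` against the `β`-integral; on differentiating, the two
  -- `exp(α s) y s` terms cancel.
  set V : ℝ → ℝ := fun s => ((∫ r in Set.Iic s, Real.exp (α * r) * y r) -
    Real.exp ((α - β) * s) * ∫ r in Set.Iic s, Real.exp (β * r) * y r) / (β - α) with hVdef
  have hV : ∀ s, HasDerivAt V
      (Real.exp ((α - β) * s) * ∫ r in Set.Iic s, Real.exp (β * r) * y r) s := by
    intro s
    have h1 : HasDerivAt (fun s : ℝ => Real.exp ((α - β) * s))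
        (Real.exp ((α - β) * s) * ((α - β) * 1)) s :=
      ((hasDerivAt_id s).const_mul (α - β)).exp
    refine (((hasDerivAt_setIntegral_Iic (by fun_prop) hiα s).sub
      (h1.mul (hasDerivAt_setIntegral_Iic (by fun_prop) hiβ s))).div_const (β - α)).congr_deriv ?_
    have h2 : Real.exp ((α - β) * s) * Real.exp (β * s) = Real.exp (α * s) := by
      rw [← Real.exp_add]; ring_nf
    rw [div_eq_iff hs]
    linear_combination -y s * h2
  have hV0 : Tendsto V atBot (𝓝 0) := by
    have h1 := tendsto_exp_mul_setIntegral_Iic (c := 0) hα.le (by linarith) hint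
    have h2 := tendsto_exp_mul_setIntegral_Iic (c := α - β) hβ.le (by linarith) hint
    simpa using (h1.sub h2).div_const (β - α)
  rw [h.eq_of_hasDerivAt hα hβ hy hint hV hV0]
  have iα := integrableOn_exp_neg_mul_comp_sub (hiα t)
  have iβ := integrableOn_exp_neg_mul_comp_sub (hiβ t)
  have hk : ∀ u, (α ^ 2 * Real.exp (-α * u) - β ^ 2 * Real.exp (-β * u)) / (α - β) * y (t - u)
      = α ^ 2 / (α - β) * (Real.exp (-α * u) * y (t - u))
        - β ^ 2 / (α - β) * (Real.exp (-β * u) * y (t - u)) := fun u => by ring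
  rw [integral_mul_sub_comp_sub
    (integrableOn_kernel_of_ne hα0 hβ0)
    (integral_kernel_of_ne hα0 hβ0 hne)
    (by simp only [hk]; exact (iα.const_mul _).sub (iβ.const_mul _))]
  simp only [hk]
  rw [integral_sub (iα.const_mul _) (iβ.const_mul _), integral_const_mul, integral_const_mul,
    ← exp_neg_mul_integral_Iic, ← exp_neg_mul_integral_Iic]
  simp only [hVdef]
  have h3 : Real.exp (-α * t) * Real.exp ((α - β) * t) = Real.exp (-β * t) := by
    rw [← Real.exp_add]; ring_nf
  rw [← h3]
  have h4 : β - α = -(α - β) := by ring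
  rw [h4]
  field_simp
  ring

/-- `T_α ∘ T_α` as a moving average of increments. -/
theorem HasIteratedOUValue.eq_integral_of_eq {α γ : ℝ} (hγ : 0 < γ) (hα : γ < α)
    {y : ℝ → ℝ} (hy : Continuous y)
    (hint : IntegrableOn (fun s => Real.exp (γ * s) * y s) (Set.Iic 0))
    {t x : ℝ} (h : HasIteratedOUValue [α, α] y t x) :
    x = ∫ u in Set.Ioi (0 : ℝ),
      (2 * α * Real.exp (-α * u) - α ^ 2 * (u * Real.exp (-α * u))) * (y t - y (t - u)) := by
  have hα0 := hγ.trans hα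
  have hiα := integrableOn_exp_mul_Iic_of_le hα.le hy hint
  -- An intermediate exponent leaves room both for the factor `s` (from `γ` to `γ'`) and for decay
  -- (from `γ'` to `α`).
  obtain ⟨γ', hγγ', hγ'α⟩ := exists_between hα
  have hint' := integrableOn_exp_mul_self_mul hγγ' hy hint
  have hy' : Continuous fun s => s * y s := by fun_prop
  have hiα' := integrableOn_exp_mul_Iic_of_le hγ'α.le hy' hint'
  -- Cauchy's formula for the iterated integral: `V s = ∫_{-∞}^s (s - r) exp(α r) y r dr`.
  set V : ℝ → ℝ := fun s => s * (∫ r in Set.Iic s, Real.exp (α * r) * y r) -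
    ∫ r in Set.Iic s, Real.exp (α * r) * (r * y r) with hVdef
  have hV : ∀ s, HasDerivAt V
      (Real.exp ((α - α) * s) * ∫ r in Set.Iic s, Real.exp (α * r) * y r) s := by
    intro s
    refine (((hasDerivAt_id s).mul (hasDerivAt_setIntegral_Iic (by fun_prop) hiα s)).sub
      (hasDerivAt_setIntegral_Iic (by fun_prop) hiα' s)).congr_deriv ?_
    simp
    ring
  have hV0 : Tendsto V atBot (𝓝 0) := by
    have h1 := tendsto_exp_mul_setIntegral_Iic (c := 0) hγ'α.le (by linarith) hint'
    -- The growing prefactor `exp(-(γ' - γ) s)` dominates `|s|` up to a constant, and the total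
    -- exponent is still `α - γ' > 0`.
    have h2 := (tendsto_exp_mul_setIntegral_Iic (c := -(γ' - γ)) hα.le (by linarith) hint).norm
    have h3 : Tendsto (fun s => s * (∫ r in Set.Iic s, Real.exp (α * r) * y r)) atBot (𝓝 0) := by
      have h4 := h2.const_mul (1 / (γ' - γ))
      rw [norm_zero, mul_zero] at h4
      refine squeeze_zero_norm' ?_ h4
      filter_upwards [eventually_le_atBot 0] with s hs
      rw [norm_mul, norm_mul, Real.norm_eq_abs, Real.norm_eq_abs (Real.exp _), Real.abs_exp,
        ← mul_assoc]
      refine mul_le_mul_of_nonneg_right ?_ (norm_nonneg _)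
      refine (abs_le_exp_neg_mul_div (sub_pos.2 hγγ') hs).trans_eq ?_
      ring
    simpa using h3.sub h1
  rw [h.eq_of_hasDerivAt hα hα hy hint hV hV0]
  have iα := integrableOn_exp_neg_mul_comp_sub (hiα t)
  have iα' := integrableOn_exp_neg_mul_comp_sub (hiα' t)
  -- Writes `u = t - (t - u)`, to match the integrals of `y` and of `s * y s`.
  have hk : ∀ u, (2 * α * Real.exp (-α * u) - α ^ 2 * (u * Real.exp (-α * u))) * y (t - u)
      = (2 * α - α ^ 2 * t) * (Real.exp (-α * u) * y (t - u))
        + α ^ 2 * (Real.exp (-α * u) * ((t - u) * y (t - u))) := fun u => by ring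
  rw [integral_mul_sub_comp_sub
    (integrableOn_kernel_of_eq hα0)
    (integral_kernel_of_eq hα0)
    (by simp only [hk]; exact (iα.const_mul _).add (iα'.const_mul _))]
  simp only [hk]
  rw [integral_add (iα.const_mul _) (iα'.const_mul _), integral_const_mul, integral_const_mul,
    ← exp_neg_mul_integral_Iic, ← exp_neg_mul_integral_Iic α (fun s => s * y s)]
  simp only [hVdef]
  ring

/-! ### Fractional Brownian motion: measurable version and Fubini -/

/-- A process which is almost surely continuous and measurable at each time agrees almost surely,
at all times, with a jointly measurable process all of whose paths are continuous. -/
theorem exists_measurable_continuous_version {Ω : Type*} [MeasurableSpace Ω] {P : Measure Ω}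
    {B : ℝ → Ω → ℝ} (hm : ∀ t, AEMeasurable (B t) P)
    (hc : ∀ᵐ ω ∂P, Continuous fun t => B t ω) :
    ∃ B' : ℝ → Ω → ℝ, Measurable (Function.uncurry B') ∧ (∀ ω, Continuous fun t => B' t ω) ∧
      ∀ᵐ ω ∂P, ∀ t, B' t ω = B t ω := by
  classical
  -- Only rational times are used, so the exceptional sets are countably many; continuity recovers
  -- the other times.
  have hq : ∀ᵐ ω ∂P, ∀ q : ℚ, B q ω = (hm q).mk (B q) ω :=
    ae_all_iff.2 fun q => (hm q).ae_eq_mk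
  obtain ⟨S, hS, hSm, hSP⟩ : ∃ S, (∀ ω ∈ S, (Continuous fun t => B t ω) ∧
      ∀ q : ℚ, B q ω = (hm q).mk (B q) ω) ∧ MeasurableSet S ∧ ∀ᵐ ω ∂P, ω ∈ S := by
    have hbad := ae_iff.1 (hc.and hq)
    refine ⟨(toMeasurable P _)ᶜ, fun ω hω => ?_, (measurableSet_toMeasurable _ _).compl,
      measure_eq_zero_iff_ae_notMem.1 ((measure_toMeasurable _).trans hbad)⟩
    by_contra hω'
    exact hω (subset_toMeasurable _ _ hω')
  have hcont : ∀ ω, Continuous fun t => if ω ∈ S then B t ω else 0 := by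
    intro ω
    by_cases h : ω ∈ S
    · simpa [h] using (hS ω h).1
    · simp [h, continuous_const]
  refine ⟨fun t ω => if ω ∈ S then B t ω else 0, ?_, hcont, ?_⟩
  · refine measurable_uncurry_of_continuous_of_measurable hcont fun t => ?_
    obtain ⟨x, hx, hxt⟩ := mem_closure_iff_seq_limit.1 (Rat.isDenseEmbedding_coe_real.dense t)
    refine measurable_of_tendsto_metrizable (f := fun n ω => if ω ∈ S then B (x n) ω else 0)
      (fun n => ?_) (tendsto_pi_nhds.2 fun ω => ((hcont ω).tendsto t).comp hxt)
    obtain ⟨q, hqx⟩ := hx n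
    have : (fun ω => if ω ∈ S then B (x n) ω else 0)
        = fun ω => if ω ∈ S then (hm q).mk (B q) ω else 0 := by
      ext ω
      split_ifs with h
      · rw [← hqx, (hS ω h).2 q]
      · rfl
    rw [this]
    exact Measurable.ite hSm (hm q).measurable_mk measurable_const
  · filter_upwards [hSP] with ω h t
    simp [h]

/-- Lets the single weight `1 + u ^ 2` control every integrability question, uniformly in `H`. -/
theorem abs_rpow_le_one_add_sq {H : ℝ} (h0 : 0 < H) (h1 : H ≤ 1) (x : ℝ) :
    |x| ^ (2 * H) ≤ 1 + x ^ 2 := by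
  rcases le_total |x| 1 with h | h
  · have := Real.rpow_le_one (abs_nonneg x) h (by linarith : 0 ≤ 2 * H)
    nlinarith [sq_nonneg x]
  · have := Real.rpow_le_rpow_of_exponent_le h (by linarith : 2 * H ≤ 2)
    rw [Real.rpow_two, sq_abs] at this
    linarith

/-- Covariance of the increments `B_t - B_{t - u}` and `B_s - B_{s - v}` of a fractional Brownian
motion, where `τ = t - s`. -/
noncomputable def incrementCov (H τ u v : ℝ) : ℝ :=
  (-|τ| ^ (2 * H) + |τ + v| ^ (2 * H) + |τ - u| ^ (2 * H) - |τ - u + v| ^ (2 * H)) / 2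

namespace IsFractionalBrownianMotion

variable {Ω : Type*} [MeasurableSpace Ω] {P : Measure Ω} {B : ℝ → Ω → ℝ} {H : ℝ}

theorem memLp_two (hB : IsFractionalBrownianMotion B H P) (t : ℝ) : MemLp (B t) 2 P :=
  (hB.gaussian.hasGaussianLaw_eval t).memLp_two

theorem exists_version (hB : IsFractionalBrownianMotion B H P) :
    ∃ B' : ℝ → Ω → ℝ, Measurable (Function.uncurry B') ∧ (∀ ω, Continuous fun t => B' t ω) ∧
      (∀ t, MemLp (B' t) 2 P) ∧
      (∀ t s, ∫ ω, B' t ω * B' s ω ∂P =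
        (|t| ^ (2 * H) + |s| ^ (2 * H) - |t - s| ^ (2 * H)) / 2) ∧
      ∀ᵐ ω ∂P, ∀ t, B' t ω = B t ω := by
  obtain ⟨B', hm, hc, he⟩ := exists_measurable_continuous_version
    (fun t => (hB.memLp_two t).aestronglyMeasurable.aemeasurable) hB.continuous_paths
  refine ⟨B', hm, hc, fun t => (hB.memLp_two t).ae_eq (he.mono fun ω h => (h t).symm),
    fun t s => ?_, he⟩
  rw [← hB.covariance]
  exact integral_congr_ae (he.mono fun ω h => by simp only [h])

/-- Since `E|B_s| ≤ 1 + E B_s² ≤ 2 + s²`, the function is integrable on the product space, hence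
along almost every path. -/
theorem ae_integrableOn_exp_mul [IsProbabilityMeasure P] (hB : IsFractionalBrownianMotion B H P)
    {γ : ℝ} (hγ : 0 < γ) :
    ∀ᵐ ω ∂P, IntegrableOn (fun s => Real.exp (γ * s) * B s ω) (Set.Iic 0) := by
  obtain ⟨B', hm, -, h2, hcov, he⟩ := hB.exists_version
  have hmeas : Measurable fun z : ℝ × Ω => Real.exp (γ * z.1) * B' z.1 z.2 :=
    (by fun_prop : Measurable fun z : ℝ × Ω => Real.exp (γ * z.1)).mul hm
  have key : Integrable (fun z : ℝ × Ω => Real.exp (γ * z.1) * B' z.1 z.2)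
      ((volume.restrict (Set.Iic 0)).prod P) := by
    rw [integrable_prod_iff hmeas.aestronglyMeasurable]
    refine ⟨ae_of_all _ fun s => ((h2 s).integrable one_le_two).const_mul (Real.exp (γ * s)), ?_⟩
    have hdom : IntegrableOn (fun s => Real.exp (γ * s) * (2 + s ^ 2)) (Set.Iic (0 : ℝ)) := by
      have h0 := integrableOn_exp_neg_mul_Ioi_zero hγ
      have h3 : IntegrableOn (fun u => 2 * Real.exp (-γ * u) + u ^ 2 * Real.exp (-γ * u))
        (Set.Ioi 0) := (h0.const_mul 2).add (integrableOn_pow_mul_exp_neg_mul_Ioi hγ 2)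
      rw [← integrableOn_Ioi_sub_iff]
      refine h3.congr_fun (fun u _ => ?_) measurableSet_Ioi
      simp only [zero_sub, mul_neg, neg_mul, neg_sq]
      ring
    refine Integrable.mono' hdom hmeas.norm.aestronglyMeasurable.integral_prod_right' ?_
    refine ae_of_all _ fun s => ?_
    rw [Real.norm_of_nonneg (integral_nonneg fun _ => norm_nonneg _)]
    simp only [norm_mul, Real.norm_eq_abs, Real.abs_exp]
    rw [integral_const_mul]
    refine mul_le_mul_of_nonneg_left ?_ (Real.exp_pos _).le
    have h5 : ∫ ω, B' s ω * B' s ω ∂P ≤ 1 + s ^ 2 := by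
      rw [hcov, sub_self, abs_zero, Real.zero_rpow (by linarith [hB.hurst_pos])]
      linarith [abs_rpow_le_one_add_sq hB.hurst_pos hB.hurst_le_one s]
    calc ∫ ω, |B' s ω| ∂P ≤ ∫ ω, (1 + B' s ω * B' s ω) ∂P := by
          refine integral_mono ((h2 s).integrable one_le_two).abs
            ((integrable_const _).add ((h2 s).integrable_mul (h2 s))) fun ω => ?_
          show |B' s ω| ≤ 1 + B' s ω * B' s ω
          rw [← abs_mul_abs_self]
          nlinarith [sq_nonneg (|B' s ω| - 1)]
      _ = 1 + ∫ ω, B' s ω * B' s ω ∂P := by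
          rw [integral_add (integrable_const _) (show Integrable (fun ω => B' s ω * B' s ω) P from
            (h2 s).integrable_mul (h2 s))]
          simp
      _ ≤ 2 + s ^ 2 := by linarith
  filter_upwards [key.prod_left_ae, he] with ω h1 h3
  simp only [h3] at h1
  exact h1

/-- Fubini on `Ω × (0, ∞)²`. The expected absolute product of two increments is at most half the sum
of their variances, so the weighted kernel gives an integrable bound. -/
theorem integrable_and_integral_movingAverage [IsProbabilityMeasure P]
    (hB : IsFractionalBrownianMotion B H P) {h : ℝ → ℝ} (hhm : Measurable h)
    (hh : IntegrableOn (fun u => |h u| * (1 + u ^ 2)) (Set.Ioi 0)) (t s : ℝ) :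
    Integrable (fun ω => (∫ u in Set.Ioi (0 : ℝ), h u * (B t ω - B (t - u) ω)) *
      ∫ v in Set.Ioi (0 : ℝ), h v * (B s ω - B (s - v) ω)) P ∧
    ∫ ω, (∫ u in Set.Ioi (0 : ℝ), h u * (B t ω - B (t - u) ω)) *
      (∫ v in Set.Ioi (0 : ℝ), h v * (B s ω - B (s - v) ω)) ∂P =
      ∫ p, h p.1 * h p.2 * incrementCov H (t - s) p.1 p.2
        ∂((volume.restrict (Set.Ioi 0)).prod (volume.restrict (Set.Ioi 0))) := by
  obtain ⟨B', hm, -, h2, hcov, he⟩ := hB.exists_version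
  set ν : Measure ℝ := volume.restrict (Set.Ioi 0) with hν
  set D : ℝ → ℝ → Ω → ℝ := fun t u ω => B' t ω - B' (t - u) ω with hD
  have hD2 : ∀ t u, MemLp (D t u) 2 P := fun t u => (h2 t).sub (h2 (t - u))
  have hDm : ∀ t, Measurable fun z : Ω × ℝ => D t z.2 z.1 := fun t =>
    (hm.comp (by fun_prop : Measurable fun z : Ω × ℝ => (t, z.1))).sub
      (hm.comp (by fun_prop : Measurable fun z : Ω × ℝ => (t - z.2, z.1)))
  have hDcov : ∀ t s u v, ∫ ω, D t u ω * D s v ω ∂P = incrementCov H (t - s) u v := by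
    intro t s u v
    have hi : ∀ a b, Integrable (fun ω => B' a ω * B' b ω) P := fun a b =>
      (h2 a).integrable_mul (h2 b)
    have hi' : ∀ a b c d, Integrable (fun ω => B' a ω * B' b ω - B' c ω * B' d ω) P :=
      fun a b c d => (hi a b).sub (hi c d)
    have e : ∀ ω, D t u ω * D s v ω = B' t ω * B' s ω - B' t ω * B' (s - v) ω
        - (B' (t - u) ω * B' s ω - B' (t - u) ω * B' (s - v) ω) := fun ω => by
      simp only [hD]; ring
    simp only [e]
    rw [integral_sub (hi' _ _ _ _) (hi' _ _ _ _),
      integral_sub (hi _ _) (hi _ _), integral_sub (hi _ _) (hi _ _), hcov, hcov, hcov, hcov,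
      incrementCov]
    have e1 : t - (s - v) = t - s + v := by ring
    have e2 : t - u - s = t - s - u := by ring
    have e3 : t - u - (s - v) = t - s - u + v := by ring
    rw [e1, e2, e3]
    ring
  have hDsq : ∀ t u, ∫ ω, D t u ω * D t u ω ∂P ≤ 1 + u ^ 2 := by
    intro t u
    rw [hDcov, incrementCov]
    simp only [sub_self, abs_zero, zero_add, zero_sub, abs_neg, neg_add_cancel]
    rw [Real.zero_rpow (by linarith [hB.hurst_pos])]
    linarith [abs_rpow_le_one_add_sq hB.hurst_pos hB.hurst_le_one u]
  set F : Ω → ℝ × ℝ → ℝ := fun ω p => h p.1 * D t p.1 ω * (h p.2 * D s p.2 ω) with hF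
  have hFm : Measurable (Function.uncurry F) :=
    ((hhm.comp (by fun_prop : Measurable fun z : Ω × ℝ × ℝ => z.2.1)).mul
      ((hDm t).comp (by fun_prop : Measurable fun z : Ω × ℝ × ℝ => (z.1, z.2.1)))).mul
    ((hhm.comp (by fun_prop : Measurable fun z : Ω × ℝ × ℝ => z.2.2)).mul
      ((hDm s).comp (by fun_prop : Measurable fun z : Ω × ℝ × ℝ => (z.1, z.2.2))))
  have hFω : ∀ p : ℝ × ℝ, (fun ω => F ω p) = fun ω => h p.1 * h p.2 * (D t p.1 ω * D s p.2 ω) :=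
    fun p => funext fun ω => by simp only [hF]; ring
  have hDD : ∀ u v, Integrable (fun ω => D t u ω * D s v ω) P := fun u v =>
    (hD2 t u).integrable_mul (hD2 s v)
  have hsq : ∀ t u, Integrable (fun ω => D t u ω * D t u ω / 2) P := fun t u =>
    ((hD2 t u).integrable_mul (hD2 t u)).div_const 2
  have hFint : Integrable (Function.uncurry F) (P.prod (ν.prod ν)) := by
    rw [integrable_prod_iff' hFm.aestronglyMeasurable]
    refine ⟨ae_of_all _ fun p => ?_, ?_⟩
    · show Integrable (fun ω => F ω p) P
      rw [hFω]
      exact (hDD _ _).const_mul _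
    · refine Integrable.mono' (hh.mul_prod hh)
        hFm.norm.aestronglyMeasurable.prod_swap.integral_prod_right' (ae_of_all _ fun p => ?_)
      rw [Real.norm_of_nonneg (integral_nonneg fun _ => norm_nonneg _)]
      show ∫ ω, ‖F ω p‖ ∂P ≤ _
      have e : ∀ ω, ‖F ω p‖ = |h p.1| * |h p.2| * |D t p.1 ω * D s p.2 ω| := fun ω => by
        simp only [hF, norm_mul, Real.norm_eq_abs, abs_mul]; ring
      simp only [e]
      rw [integral_const_mul]
      have h3 : ∫ ω, |D t p.1 ω * D s p.2 ω| ∂P ≤ (1 + p.1 ^ 2) * (1 + p.2 ^ 2) := by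
        calc ∫ ω, |D t p.1 ω * D s p.2 ω| ∂P
            ≤ ∫ ω, (D t p.1 ω * D t p.1 ω / 2 + D s p.2 ω * D s p.2 ω / 2) ∂P := by
              refine integral_mono (hDD _ _).abs
                ((hsq t p.1).add (hsq s p.2)) fun ω => ?_
              show |D t p.1 ω * D s p.2 ω| ≤
                D t p.1 ω * D t p.1 ω / 2 + D s p.2 ω * D s p.2 ω / 2
              rw [abs_le]
              constructor
              · nlinarith [sq_nonneg (D t p.1 ω + D s p.2 ω)]
              · nlinarith [sq_nonneg (D t p.1 ω - D s p.2 ω)]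
          _ = (∫ ω, D t p.1 ω * D t p.1 ω ∂P) / 2 + (∫ ω, D s p.2 ω * D s p.2 ω ∂P) / 2 := by
              rw [integral_add (hsq t p.1) (hsq s p.2), integral_div, integral_div]
          _ ≤ (1 + p.1 ^ 2) * (1 + p.2 ^ 2) := by
              nlinarith [hDsq t p.1, hDsq s p.2, sq_nonneg p.1, sq_nonneg p.2,
                mul_nonneg (sq_nonneg p.1) (sq_nonneg p.2)]
      calc _ ≤ |h p.1| * |h p.2| * ((1 + p.1 ^ 2) * (1 + p.2 ^ 2)) := by gcongr
        _ = _ := by ring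
  have hprod : ∀ᵐ ω ∂P, (∫ u in Set.Ioi (0 : ℝ), h u * (B t ω - B (t - u) ω)) *
      (∫ v in Set.Ioi (0 : ℝ), h v * (B s ω - B (s - v) ω)) = ∫ p, F ω p ∂(ν.prod ν) := by
    filter_upwards [he] with ω hω
    simp only [← hω, hF]
    exact (integral_prod_mul (fun u => h u * D t u ω) fun v => h v * D s v ω).symm
  refine ⟨(integrable_congr hprod).2 hFint.integral_prod_left, ?_⟩
  rw [integral_congr_ae hprod, integral_integral_swap hFint]
  refine integral_congr_ae (ae_of_all _ fun p => ?_)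
  show ∫ ω, F ω p ∂P = _
  rw [hFω, integral_const_mul, hDcov]

end IsFractionalBrownianMotion

/-! ### Reduction of the double integral to the autocorrelation of the kernel -/

theorem integrable_mul_of_le_const_mul_one_add_sq {k G : ℝ → ℝ} (hk : Measurable k)
    (hki : IntegrableOn (fun u => |k u| * (1 + u ^ 2)) (Set.Ioi 0)) (hG : Measurable G) {C : ℝ}
    (hGC : ∀ u, |G u| ≤ C * (1 + u ^ 2)) : IntegrableOn (fun u => k u * G u) (Set.Ioi 0) := by
  refine Integrable.mono' (hki.const_mul C) (hk.mul hG).aestronglyMeasurable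
    (ae_of_all _ fun u => ?_)
  rw [norm_mul, Real.norm_eq_abs, Real.norm_eq_abs]
  calc |k u| * |G u| ≤ |k u| * (C * (1 + u ^ 2)) := by gcongr; exact hGC u
    _ = _ := by ring

/-- Double integrals of a function of the difference reduce to the autocorrelation `ρ`. -/
theorem integral_prod_comp_sub_eq_autocorrelation {h ρ g : ℝ → ℝ} (τ : ℝ)
    (hint : Integrable (fun p : ℝ × ℝ => h p.1 * h p.2 * g (τ - p.1 + p.2))
      ((volume.restrict (Set.Ioi 0)).prod (volume.restrict (Set.Ioi 0))))
    (hρ : ∀ w, 0 ≤ w → ∫ v in Set.Ioi (0 : ℝ), h v * h (v + w) = ρ w) :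
    ∫ p : ℝ × ℝ, h p.1 * h p.2 * g (τ - p.1 + p.2)
        ∂((volume.restrict (Set.Ioi 0)).prod (volume.restrict (Set.Ioi 0)))
      = ∫ w in Set.Ioi (0 : ℝ), ρ w * (g (τ - w) + g (τ + w)) := by
  -- Extending by zero to the line makes translation-invariant substitutions available.
  set k : ℝ → ℝ := (Set.Ioi 0).indicator h with hk
  have hkh : ∀ u, 0 < u → k u = h u := fun u hu => Set.indicator_of_mem (Set.mem_Ioi.2 hu) h
  have hk0 : ∀ u, u ≤ 0 → k u = 0 := fun u hu =>
    Set.indicator_of_notMem (by simpa using hu) h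
  have hind : ∀ p : ℝ × ℝ, (Set.Ioi 0 ×ˢ Set.Ioi 0 : Set (ℝ × ℝ)).indicator
      (fun p => h p.1 * h p.2 * g (τ - p.1 + p.2)) p = k p.1 * k p.2 * g (τ - p.1 + p.2) := by
    intro p
    by_cases h1 : 0 < p.1
    · by_cases h2 : 0 < p.2
      · rw [Set.indicator_of_mem (show p ∈ Set.Ioi 0 ×ˢ Set.Ioi 0 from ⟨h1, h2⟩),
          hkh _ h1, hkh _ h2]
      · rw [Set.indicator_of_notMem (fun hp => h2 hp.2), hk0 _ (not_lt.1 h2)]; ring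
    · rw [Set.indicator_of_notMem (fun hp => h1 hp.1), hk0 _ (not_lt.1 h1)]; ring
  have hms : MeasurableSet (Set.Ioi 0 ×ˢ Set.Ioi 0 : Set (ℝ × ℝ)) :=
    measurableSet_Ioi.prod measurableSet_Ioi
  rw [Measure.prod_restrict] at hint ⊢
  have hK : Integrable (fun p : ℝ × ℝ => k p.1 * k p.2 * g (τ - p.1 + p.2))
      (volume.prod volume) := by
    have := (integrable_indicator_iff hms).2 hint
    rwa [funext hind] at this
  rw [← integral_indicator hms, funext hind]
  -- The shear `(w, v) ↦ (w + v, v)` preserves the measure and makes the argument of `g` depend on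
  -- `w` alone.
  have hmp := measurePreserving_add_prod (volume : Measure ℝ) (volume : Measure ℝ)
  have hshift : ∀ z : ℝ × ℝ, k (z.1 + z.2) * k z.2 * g (τ - (z.1 + z.2) + z.2)
      = k (z.1 + z.2) * k z.2 * g (τ - z.1) := fun z => by
    rw [show τ - (z.1 + z.2) + z.2 = τ - z.1 by ring]
  have hK' : Integrable (fun z : ℝ × ℝ => k (z.1 + z.2) * k z.2 * g (τ - z.1))
      (volume.prod volume) := by
    have := (hmp.integrable_comp hK.aestronglyMeasurable).2 hK
    simpa only [Function.comp_def, hshift] using this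
  have hstep : ∫ p : ℝ × ℝ, k p.1 * k p.2 * g (τ - p.1 + p.2) ∂(volume.prod volume)
      = ∫ z : ℝ × ℝ, k (z.1 + z.2) * k z.2 * g (τ - z.1) ∂(volume.prod volume) := by
    conv_lhs => rw [← hmp.map_eq]
    rw [integral_map hmp.measurable.aemeasurable
      (by rw [hmp.map_eq]; exact hK.aestronglyMeasurable)]
    simp only [hshift]
  rw [hstep, integral_prod _ hK']
  set R : ℝ → ℝ := fun w => ∫ v, k (w + v) * k v with hR
  have hRpos : ∀ w, 0 ≤ w → R w = ρ w := by
    intro w hw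
    rw [← hρ w hw, ← integral_indicator measurableSet_Ioi]
    refine integral_congr_ae (ae_of_all _ fun v => ?_)
    by_cases hv : 0 < v
    · show k (w + v) * k v = _
      rw [Set.indicator_of_mem (Set.mem_Ioi.2 hv), hkh v hv, hkh (w + v) (by linarith),
        add_comm w v, mul_comm]
    · show k (w + v) * k v = _
      rw [Set.indicator_of_notMem (show v ∉ Set.Ioi 0 from hv), hk0 v (not_lt.1 hv), mul_zero]
  -- Evenness folds the negative half-line onto the positive one, giving the symmetric sum `g (τ -
  -- w) + g (τ + w)`.
  have hReven : ∀ w, R (-w) = R w := by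
    intro w
    show ∫ v, k (-w + v) * k v = ∫ v, k (w + v) * k v
    rw [← integral_add_left_eq_self (fun v => k (-w + v) * k v) w]
    refine integral_congr_ae (ae_of_all _ fun v => ?_)
    show k (-w + (w + v)) * k (w + v) = _
    rw [neg_add_cancel_left, mul_comm]
  have hinner : ∀ w, ∫ v, k (w + v) * k v * g (τ - w) = R w * g (τ - w) := fun w =>
    integral_mul_const _ _
  simp only [hinner]
  have hRi : Integrable fun w => R w * g (τ - w) := by
    have := hK'.integral_prod_left
    simpa only [hinner] using this
  have hRi' : Integrable fun w => R w * g (τ + w) := by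
    have := hRi.comp_neg
    simpa only [hReven, sub_neg_eq_add] using this
  rw [← intervalIntegral.integral_Iic_add_Ioi (b := 0) hRi.integrableOn hRi.integrableOn]
  have hneg := integral_comp_neg_Ioi (0 : ℝ) fun w => R w * g (τ - w)
  rw [neg_zero] at hneg
  rw [← hneg]
  simp only [hReven, sub_neg_eq_add]
  rw [← integral_add hRi'.integrableOn hRi.integrableOn]
  refine setIntegral_congr_fun measurableSet_Ioi fun w hw => ?_
  show R w * g (τ + w) + R w * g (τ - w) = _
  rw [hRpos w (Set.mem_Ioi.1 hw).le]
  ring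

theorem continuous_abs_rpow {H : ℝ} (hH : 0 < H) : Continuous fun x : ℝ => |x| ^ (2 * H) :=
  continuous_abs.rpow_const fun _ => Or.inr (by linarith)

theorem abs_abs_rpow_add_le {H : ℝ} (h0 : 0 < H) (h1 : H ≤ 1) (τ u : ℝ) :
    |(|τ + u| ^ (2 * H))| ≤ 2 * (1 + τ ^ 2) * (1 + u ^ 2) := by
  rw [abs_of_nonneg (by positivity)]
  refine (abs_rpow_le_one_add_sq h0 h1 _).trans ?_
  nlinarith [sq_nonneg (τ - u), mul_nonneg (sq_nonneg τ) (sq_nonneg u)]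

theorem abs_abs_rpow_sub_le {H : ℝ} (h0 : 0 < H) (h1 : H ≤ 1) (τ u : ℝ) :
    |(|τ - u| ^ (2 * H))| ≤ 2 * (1 + τ ^ 2) * (1 + u ^ 2) := by
  simpa [sub_eq_add_neg] using abs_abs_rpow_add_le h0 h1 τ (-u)

/-- Of the four powers in `incrementCov`, three depend on at most one of the variables and collapse
because `h` has mass one; only the last needs the autocorrelation. -/
theorem integral_prod_incrementCov {h ρ : ℝ → ℝ} {H : ℝ} (h0 : 0 < H) (h1 : H ≤ 1) (τ : ℝ)
    (hhm : Measurable h) (hh : IntegrableOn (fun u => |h u| * (1 + u ^ 2)) (Set.Ioi 0))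
    (hone : ∫ u in Set.Ioi (0 : ℝ), h u = 1)
    (hρm : Measurable ρ) (hρi : IntegrableOn (fun u => |ρ u| * (1 + u ^ 2)) (Set.Ioi 0))
    (hρ : ∀ w, 0 ≤ w → ∫ v in Set.Ioi (0 : ℝ), h v * h (v + w) = ρ w) :
    ∫ p : ℝ × ℝ, h p.1 * h p.2 * incrementCov H τ p.1 p.2
        ∂((volume.restrict (Set.Ioi 0)).prod (volume.restrict (Set.Ioi 0)))
      = ((∫ w in Set.Ioi (0 : ℝ), (h w - ρ w) * (|τ - w| ^ (2 * H) + |τ + w| ^ (2 * H)))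
          - |τ| ^ (2 * H)) / 2 := by
  set ν : Measure ℝ := volume.restrict (Set.Ioi 0) with hν
  have hgc := continuous_abs_rpow h0
  have hi : Integrable h ν := by
    have : IntegrableOn (fun u => h u * 1) (Set.Ioi 0) :=
      integrable_mul_of_le_const_mul_one_add_sq (C := 1) hhm hh measurable_const
        fun u => by rw [abs_one]; nlinarith [sq_nonneg u]
    simp only [mul_one] at this
    exact this
  have hsub : ∀ {k : ℝ → ℝ}, Measurable k → IntegrableOn (fun u => |k u| * (1 + u ^ 2)) (Set.Ioi 0)
      → Integrable (fun u => k u * |τ - u| ^ (2 * H)) ν := fun hk hki =>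
    integrable_mul_of_le_const_mul_one_add_sq hk hki
      (hgc.comp (by fun_prop : Continuous fun u => τ - u)).measurable (abs_abs_rpow_sub_le h0 h1 τ)
  have hadd : ∀ {k : ℝ → ℝ}, Measurable k → IntegrableOn (fun u => |k u| * (1 + u ^ 2)) (Set.Ioi 0)
      → Integrable (fun u => k u * |τ + u| ^ (2 * H)) ν := fun hk hki =>
    integrable_mul_of_le_const_mul_one_add_sq hk hki
      (hgc.comp (by fun_prop : Continuous fun u => τ + u)).measurable (abs_abs_rpow_add_le h0 h1 τ)
  have i1 : Integrable (fun p : ℝ × ℝ => h p.1 * h p.2) (ν.prod ν) := hi.mul_prod hi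
  have i2 : Integrable (fun p : ℝ × ℝ => h p.1 * (h p.2 * |τ + p.2| ^ (2 * H))) (ν.prod ν) :=
    hi.mul_prod (hadd hhm hh)
  have i3 : Integrable (fun p : ℝ × ℝ => h p.1 * |τ - p.1| ^ (2 * H) * h p.2) (ν.prod ν) :=
    (hsub hhm hh).mul_prod hi
  have i4 : Integrable (fun p : ℝ × ℝ => h p.1 * h p.2 * |τ - p.1 + p.2| ^ (2 * H))
      (ν.prod ν) := by
    refine Integrable.mono' ((hh.mul_prod hh).const_mul (4 * (1 + τ ^ 2))) ?_
      (ae_of_all _ fun p => ?_)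
    · exact (((hhm.comp measurable_fst).mul (hhm.comp measurable_snd)).mul
        (hgc.comp (by fun_prop : Continuous fun p : ℝ × ℝ => τ - p.1 + p.2)).measurable
        ).aestronglyMeasurable
    · have hb : |(|τ - p.1 + p.2| ^ (2 * H))|
          ≤ 4 * (1 + τ ^ 2) * ((1 + p.1 ^ 2) * (1 + p.2 ^ 2)) := by
        refine (abs_abs_rpow_add_le h0 h1 (τ - p.1) p.2).trans ?_
        have : 1 + (τ - p.1) ^ 2 ≤ 2 * (1 + τ ^ 2) * (1 + p.1 ^ 2) := by
          nlinarith [sq_nonneg (τ + p.1), mul_nonneg (sq_nonneg τ) (sq_nonneg p.1)]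
        calc 2 * (1 + (τ - p.1) ^ 2) * (1 + p.2 ^ 2)
            ≤ 2 * (2 * (1 + τ ^ 2) * (1 + p.1 ^ 2)) * (1 + p.2 ^ 2) := by gcongr
          _ = _ := by ring
      rw [norm_mul, norm_mul]
      simp only [Real.norm_eq_abs]
      calc |h p.1| * |h p.2| * |(|τ - p.1 + p.2| ^ (2 * H))|
          ≤ |h p.1| * |h p.2| * (4 * (1 + τ ^ 2) * ((1 + p.1 ^ 2) * (1 + p.2 ^ 2))) := by gcongr
        _ = _ := by ring
  have e : ∀ p : ℝ × ℝ, h p.1 * h p.2 * incrementCov H τ p.1 p.2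
      = 1 / 2 * ((h p.1 * (h p.2 * |τ + p.2| ^ (2 * H)) + h p.1 * |τ - p.1| ^ (2 * H) * h p.2)
        - (|τ| ^ (2 * H) * (h p.1 * h p.2) + h p.1 * h p.2 * |τ - p.1 + p.2| ^ (2 * H))) :=
    fun p => by rw [incrementCov]; ring
  simp only [e]
  have i23 : Integrable (fun p : ℝ × ℝ => h p.1 * (h p.2 * |τ + p.2| ^ (2 * H))
    + h p.1 * |τ - p.1| ^ (2 * H) * h p.2) (ν.prod ν) := i2.add i3
  have i14 : Integrable (fun p : ℝ × ℝ => |τ| ^ (2 * H) * (h p.1 * h p.2)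
    + h p.1 * h p.2 * |τ - p.1 + p.2| ^ (2 * H)) (ν.prod ν) := (i1.const_mul _).add i4
  rw [integral_const_mul, integral_sub i23 i14, integral_add i2 i3,
    integral_add (i1.const_mul _) i4, integral_const_mul,
    integral_prod_mul h h, integral_prod_mul h (fun v => h v * |τ + v| ^ (2 * H)),
    integral_prod_mul (fun u => h u * |τ - u| ^ (2 * H)) h, hone,
    integral_prod_comp_sub_eq_autocorrelation (g := fun x => |x| ^ (2 * H)) τ
      i4 hρ]
  have e2 : ∀ w, (h w - ρ w) * (|τ - w| ^ (2 * H) + |τ + w| ^ (2 * H))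
      = (h w * |τ - w| ^ (2 * H) + h w * |τ + w| ^ (2 * H))
        - ρ w * (|τ - w| ^ (2 * H) + |τ + w| ^ (2 * H)) := fun w => by ring
  have j1 : Integrable (fun w => h w * |τ - w| ^ (2 * H) + h w * |τ + w| ^ (2 * H)) ν :=
    (hsub hhm hh).add (hadd hhm hh)
  have j2 : Integrable (fun w => ρ w * (|τ - w| ^ (2 * H) + |τ + w| ^ (2 * H))) ν := by
    simp only [mul_add]
    exact (hsub hρm hρi).add (hadd hρm hρi)
  simp only [e2]
  rw [integral_sub j1 j2, integral_add (hsub hhm hh) (hadd hhm hh)]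
  ring

/-! ### The Laplace transform that produces `fH` -/

theorem intervalIntegrable_exp_mul_rpow {p : ℝ} (hp : 0 < p) (c x : ℝ) :
    IntervalIntegrable (fun r => Real.exp (c * r) * r ^ (p - 1)) volume 0 x :=
  (intervalIntegral.intervalIntegrable_rpow' (by linarith)).continuousOn_mul
    (by fun_prop : Continuous fun r => Real.exp (c * r)).continuousOn

/-- Passes from the exponent `2H` of the covariance to the exponent `2H - 1` in `fH`. Since `r ^ (p
- 1)` may be singular at `0`, the derivative is used only in the open interval. -/
theorem integral_exp_mul_rpow_by_parts {p : ℝ} (hp : 0 < p) (c : ℝ) {x : ℝ} (hx : 0 ≤ x) :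
    c * (∫ r in (0 : ℝ)..x, Real.exp (c * r) * r ^ p)
      = Real.exp (c * x) * x ^ p - p * ∫ r in (0 : ℝ)..x, Real.exp (c * r) * r ^ (p - 1) := by
  have hpc : Continuous fun r : ℝ => r ^ p := Real.continuous_rpow_const hp.le
  have hc : Continuous fun r : ℝ => Real.exp (c * r) * r ^ p := by fun_prop
  have i1 : IntervalIntegrable (fun r => c * (Real.exp (c * r) * r ^ p)) volume 0 x :=
    (hc.intervalIntegrable _ _).const_mul c
  have i2 := (intervalIntegrable_exp_mul_rpow hp c x).const_mul p
  have h := intervalIntegral.integral_eq_sub_of_hasDerivAt_of_le hx hc.continuousOn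
    (f' := fun r => c * (Real.exp (c * r) * r ^ p) + p * (Real.exp (c * r) * r ^ (p - 1)))
    (fun r hr => by
      have h1 : HasDerivAt (fun r : ℝ => Real.exp (c * r)) (Real.exp (c * r) * (c * 1)) r :=
        ((hasDerivAt_id r).const_mul c).exp
      refine (h1.mul (Real.hasDerivAt_rpow_const (p := p) (Or.inl hr.1.ne'))).congr_deriv ?_
      ring) (i1.add i2)
  rw [intervalIntegral.integral_add i1 i2, intervalIntegral.integral_const_mul,
    intervalIntegral.integral_const_mul, Real.zero_rpow hp.ne', mul_zero, sub_zero] at h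
  linarith

theorem integrableOn_Iic_exp_mul_abs_rpow {p : ℝ} (hp : 0 < p) (t : ℝ) :
    IntegrableOn (fun r => Real.exp (1 * r) * |r| ^ p) (Set.Iic t) := by
  refine integrableOn_exp_mul_Iic_of_le le_rfl
    (continuous_abs.rpow_const fun _ => Or.inr hp.le) ?_ t
  rw [← integrableOn_Ioi_sub_iff]
  have h := Real.GammaIntegral_convergent (s := p + 1) (by linarith)
  refine h.congr_fun (fun u hu => ?_) measurableSet_Ioi
  simp only [zero_sub, abs_neg, one_mul, add_sub_cancel_right, abs_of_pos (Set.mem_Ioi.1 hu)]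

theorem integral_Iic_exp_mul_abs_rpow_zero {p : ℝ} (hp : 0 < p) :
    ∫ r in Set.Iic (0 : ℝ), Real.exp (1 * r) * |r| ^ p = p * Real.Gamma p := by
  rw [← Real.Gamma_add_one hp.ne', Real.Gamma_eq_integral (by linarith),
    integral_Iic_eq_integral_Ioi_sub]
  refine setIntegral_congr_fun measurableSet_Ioi fun u hu => ?_
  simp only [zero_sub, abs_neg, one_mul, add_sub_cancel_right, abs_of_pos (Set.mem_Ioi.1 hu)]

/-- Reflection turns the two halves into integrals of `exp(r) |r|^{2H}` over `(-∞, x]` and `(-∞,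
-x]`. Comparing each with the integral up to `0`, which is `2H Γ(2H)`, leaves integrals over `[0,
x]`; parts then gives `fH`, with one boundary term `x^{2H}` from each half. -/
theorem integral_exp_neg_mul_abs_rpow {H : ℝ} (hH : 0 < H) {x : ℝ} (hx : 0 ≤ x) :
    ∫ w in Set.Ioi (0 : ℝ), Real.exp (-w) * (|x - w| ^ (2 * H) + |x + w| ^ (2 * H))
      = 2 * x ^ (2 * H) + 2 * H * fH H x := by
  have hp : 0 < 2 * H := by linarith
  have hF := fun t => integrableOn_Iic_exp_mul_abs_rpow hp t
  set F : ℝ → ℝ := fun r => Real.exp (1 * r) * |r| ^ (2 * H) with hFdef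
  have e1 : ∀ w, Real.exp (-w) * |x - w| ^ (2 * H) = Real.exp (-x) * F (x - w) := fun w => by
    simp only [hFdef]
    rw [← mul_assoc, ← Real.exp_add]; ring_nf
  have e2 : ∀ w, Real.exp (-w) * |x + w| ^ (2 * H) = Real.exp x * F (-x - w) := fun w => by
    simp only [hFdef]
    rw [← mul_assoc, ← Real.exp_add, ← abs_neg (-x - w)]; ring_nf
  have i1 : IntegrableOn (fun w => Real.exp (-x) * F (x - w)) (Set.Ioi 0) :=
    (integrableOn_Ioi_sub_iff.2 (hF x)).const_mul _
  have i2 : IntegrableOn (fun w => Real.exp x * F (-x - w)) (Set.Ioi 0) :=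
    (integrableOn_Ioi_sub_iff.2 (hF (-x))).const_mul _
  simp only [mul_add, e1, e2]
  rw [integral_add i1 i2, integral_const_mul, integral_const_mul,
    ← integral_Iic_eq_integral_Ioi_sub, ← integral_Iic_eq_integral_Ioi_sub]
  have hx1 := intervalIntegral.integral_Iic_sub_Iic (hF 0) (hF x)
  have hx2 := intervalIntegral.integral_Iic_sub_Iic (hF (-x)) (hF 0)
  rw [integral_Iic_exp_mul_abs_rpow_zero hp] at hx1 hx2
  have h1 : ∫ r in (0 : ℝ)..x, F r = ∫ r in (0 : ℝ)..x, Real.exp (1 * r) * r ^ (2 * H) := by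
    refine intervalIntegral.integral_congr fun r hr => ?_
    rw [Set.uIcc_of_le hx] at hr
    simp only [hFdef, abs_of_nonneg hr.1]
  have h2 : ∫ r in (-x)..0, F r = ∫ r in (0 : ℝ)..x, Real.exp (-1 * r) * r ^ (2 * H) := by
    have := intervalIntegral.integral_comp_neg (a := 0) (b := x) F
    rw [neg_zero] at this
    rw [← this]
    refine intervalIntegral.integral_congr fun r hr => ?_
    rw [Set.uIcc_of_le hx] at hr
    simp only [hFdef, abs_neg, abs_of_nonneg hr.1]
    ring_nf
  rw [h1] at hx1
  rw [h2] at hx2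
  have p1 := integral_exp_mul_rpow_by_parts hp 1 hx
  have p2 := integral_exp_mul_rpow_by_parts hp (-1) hx
  have hxx : Real.exp (-x) * Real.exp x = 1 := by rw [← Real.exp_add]; simp
  rw [fH]
  simp only [one_mul, neg_mul] at hx1 hx2 p1 p2 ⊢
  linear_combination Real.exp (-x) * hx1 - Real.exp x * hx2 + Real.exp (-x) * p1
    + Real.exp x * p2 + 2 * x ^ (2 * H) * hxx

/-- The Laplace transform of `w ↦ |τ - w|^{2H} + |τ + w|^{2H}`. -/
theorem integral_exp_neg_mul_mul_abs_rpow {H lam τ : ℝ} (hH : 0 < H) (hlam : 0 < lam)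
    (hτ : 0 ≤ τ) :
    ∫ w in Set.Ioi (0 : ℝ), Real.exp (-lam * w) * (|τ - w| ^ (2 * H) + |τ + w| ^ (2 * H))
      = 2 * τ ^ (2 * H) / lam + 2 * H * lam ^ (-1 - 2 * H) * fH H (lam * τ) := by
  have h := integral_comp_mul_left_Ioi
    (fun w => Real.exp (-w) * (|lam * τ - w| ^ (2 * H) + |lam * τ + w| ^ (2 * H))) 0 hlam
  rw [mul_zero, integral_exp_neg_mul_abs_rpow hH (by positivity)] at h
  have e : ∀ w, Real.exp (-(lam * w)) *
      (|lam * τ - lam * w| ^ (2 * H) + |lam * τ + lam * w| ^ (2 * H))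
      = lam ^ (2 * H) *
        (Real.exp (-lam * w) * (|τ - w| ^ (2 * H) + |τ + w| ^ (2 * H))) := fun w => by
    rw [← mul_sub, ← mul_add, abs_mul, abs_mul, abs_of_pos hlam,
      Real.mul_rpow hlam.le (abs_nonneg _), Real.mul_rpow hlam.le (abs_nonneg _), neg_mul]
    ring
  simp only [e] at h
  rw [integral_const_mul, Real.mul_rpow hlam.le hτ, smul_eq_mul] at h
  have hl : 0 < lam ^ (2 * H) := Real.rpow_pos_of_pos hlam _
  have e3 : lam ^ (-1 - 2 * H) = lam⁻¹ * (lam ^ (2 * H))⁻¹ := by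
    rw [sub_eq_add_neg, Real.rpow_add hlam, Real.rpow_neg_one, Real.rpow_neg hlam.le]
  rw [e3]
  refine mul_left_cancel₀ hl.ne' (h.trans ?_)
  field_simp

theorem differentiableAt_fH {H x : ℝ} (hH : 0 < H) (hx : 0 < x) :
    DifferentiableAt ℝ (fH H) x := by
  have hp : 0 < 2 * H := by linarith
  have key : ∀ c : ℝ, DifferentiableAt ℝ
      (fun x => ∫ s in (0 : ℝ)..x, Real.exp (c * s) * s ^ (2 * H - 1)) x := by
    intro c
    refine (intervalIntegral.integral_hasDerivAt_right (intervalIntegrable_exp_mul_rpow hp c x)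
      ?_ ?_).differentiableAt
    · exact (by fun_prop : Measurable fun s : ℝ =>
        Real.exp (c * s) * s ^ (2 * H - 1)).stronglyMeasurable.stronglyMeasurableAtFilter
    · exact (by fun_prop : Continuous fun s => Real.exp (c * s)).continuousAt.mul
        (Real.continuousAt_rpow_const _ _ (Or.inl hx.ne'))
  have k1 := key 1
  have k2 := key (-1)
  simp only [one_mul, neg_mul] at k1 k2
  unfold fH
  fun_prop

theorem hasDerivAt_fH_mul_const {H α τ : ℝ} (hH : 0 < H) (hα : 0 < α) (hτ : 0 ≤ τ) :
    HasDerivAt (fun lam => fH H (lam * τ)) (τ * deriv (fH H) (α * τ)) α := by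
  -- At `τ = 0` the function is constant and the factor `τ` annihilates whatever value `deriv` takes
  -- at `0`.
  rcases hτ.eq_or_lt with rfl | hτ
  · simpa using hasDerivAt_const α (fH H 0)
  · have h1 := (differentiableAt_fH hH (mul_pos hα hτ)).hasDerivAt
    have h2 : HasDerivAt (fun lam : ℝ => lam * τ) (1 * τ) α := (hasDerivAt_id α).mul_const τ
    refine (h1.comp α h2).congr_deriv ?_
    ring

theorem integrableOn_pow_mul_exp_neg_mul_one_add_sq {c : ℝ} (hc : 0 < c) (n : ℕ) :
    IntegrableOn (fun u => u ^ n * Real.exp (-c * u) * (1 + u ^ 2)) (Set.Ioi 0) := by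
  have e : ∀ u : ℝ, u ^ n * Real.exp (-c * u) * (1 + u ^ 2)
      = u ^ n * Real.exp (-c * u) + u ^ (n + 2) * Real.exp (-c * u) := fun u => by ring
  simp only [e]
  exact (integrableOn_pow_mul_exp_neg_mul_Ioi hc n).add
    (integrableOn_pow_mul_exp_neg_mul_Ioi hc (n + 2))

theorem integrableOn_abs_mul_one_add_sq {k : ℝ → ℝ}
    (hk : IntegrableOn (fun u => k u * (1 + u ^ 2)) (Set.Ioi 0)) :
    IntegrableOn (fun u => |k u| * (1 + u ^ 2)) (Set.Ioi 0) := by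
  refine IntegrableOn.congr_fun (f := fun u => |k u * (1 + u ^ 2)|) hk.abs (fun u _ => ?_)
    measurableSet_Ioi
  show |k u * (1 + u ^ 2)| = _
  rw [abs_mul, abs_of_nonneg (by positivity : 0 ≤ 1 + u ^ 2)]

theorem integrableOn_mul_abs_rpow {k : ℝ → ℝ} {H : ℝ} (h0 : 0 < H) (h1 : H ≤ 1) (τ : ℝ)
    (hkm : Measurable k) (hk : IntegrableOn (fun u => k u * (1 + u ^ 2)) (Set.Ioi 0)) :
    IntegrableOn (fun w => k w * (|τ - w| ^ (2 * H) + |τ + w| ^ (2 * H))) (Set.Ioi 0) := by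
  have hgc := continuous_abs_rpow h0
  have ha := integrableOn_abs_mul_one_add_sq hk
  simp only [mul_add]
  exact (integrable_mul_of_le_const_mul_one_add_sq hkm ha
      (hgc.comp (by fun_prop : Continuous fun u => τ - u)).measurable
      (abs_abs_rpow_sub_le h0 h1 τ)).add
    (integrable_mul_of_le_const_mul_one_add_sq hkm ha
      (hgc.comp (by fun_prop : Continuous fun u => τ + u)).measurable
      (abs_abs_rpow_add_le h0 h1 τ))

theorem integrableOn_pow_mul_exp_neg_mul_abs_rpow {H c : ℝ} (h0 : 0 < H) (h1 : H ≤ 1)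
    (hc : 0 < c) (τ : ℝ) (n : ℕ) :
    IntegrableOn (fun w => w ^ n * Real.exp (-c * w) *
      (|τ - w| ^ (2 * H) + |τ + w| ^ (2 * H))) (Set.Ioi 0) :=
  integrableOn_mul_abs_rpow h0 h1 τ (by fun_prop)
    (integrableOn_pow_mul_exp_neg_mul_one_add_sq hc n)

/-- Minus the derivative of the Laplace transform with respect to the rate, computed once under the
integral sign and once from the closed form. -/
theorem integral_mul_exp_neg_mul_mul_abs_rpow {H α τ : ℝ} (h0 : 0 < H) (h1 : H ≤ 1)
    (hα : 0 < α) (hτ : 0 ≤ τ) :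
    ∫ w in Set.Ioi (0 : ℝ), w * Real.exp (-α * w) * (|τ - w| ^ (2 * H) + |τ + w| ^ (2 * H))
      = 2 * τ ^ (2 * H) / α ^ 2 - 2 * H * ((-1 - 2 * H) * α ^ (-2 - 2 * H) * fH H (α * τ)
        + α ^ (-1 - 2 * H) * (τ * deriv (fH H) (α * τ))) := by
  set G : ℝ → ℝ := fun w => |τ - w| ^ (2 * H) + |τ + w| ^ (2 * H) with hG
  have hgc := continuous_abs_rpow h0
  have hGm : Measurable G := by
    have a1 := (hgc.comp (by fun_prop : Continuous fun u => τ - u)).measurable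
    have a2 := (hgc.comp (by fun_prop : Continuous fun u => τ + u)).measurable
    exact a1.add a2
  have hG0 : ∀ w, 0 ≤ G w := fun w => by simp only [hG]; positivity
  have i0 := integrableOn_pow_mul_exp_neg_mul_abs_rpow h0 h1 hα τ 0
  have i1 := integrableOn_pow_mul_exp_neg_mul_abs_rpow h0 h1 (half_pos hα) τ 1
  simp only [pow_zero, pow_one, one_mul] at i0 i1
  -- Rates are kept above `α / 2`, so the exponential at rate `α / 2` dominates the derivatives.
  have hd := (hasDerivAt_integral_of_dominated_loc_of_deriv_le
    (μ := volume.restrict (Set.Ioi (0 : ℝ))) (F := fun lam w => Real.exp (-lam * w) * G w)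
    (F' := fun lam w => -(w * Real.exp (-lam * w) * G w)) (x₀ := α) (s := Set.Ioi (α / 2))
    (bound := fun w => w * Real.exp (-(α / 2) * w) * G w)
    (Ioi_mem_nhds (half_lt_self hα))
    (Eventually.of_forall fun lam => ((by fun_prop : Measurable fun w : ℝ =>
      Real.exp (-lam * w)).mul hGm).aestronglyMeasurable) i0
    (((by fun_prop : Measurable fun w : ℝ => w * Real.exp (-α * w)).mul hGm).neg
      ).aestronglyMeasurable ?_ i1 ?_).2
  rotate_left
  · filter_upwards [ae_restrict_mem measurableSet_Ioi] with w hw lam hlam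
    have hw : 0 < w := hw
    have hlam : α / 2 < lam := hlam
    rw [norm_neg, norm_mul, Real.norm_of_nonneg (hG0 w),
      Real.norm_of_nonneg (by positivity : 0 ≤ w * Real.exp (-lam * w))]
    have : -lam * w ≤ -(α / 2) * w := by nlinarith
    gcongr
  · refine ae_of_all _ fun w lam _ => ?_
    have h2 : HasDerivAt (fun lam : ℝ => -lam * w) (-1 * w) lam :=
      (hasDerivAt_id lam).neg.mul_const w
    refine (h2.exp.mul_const (G w)).congr_deriv ?_
    ring
  have hf : HasDerivAt (fun lam => 2 * τ ^ (2 * H) / lam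
      + 2 * H * lam ^ (-1 - 2 * H) * fH H (lam * τ))
      (2 * τ ^ (2 * H) * (-(α ^ 2)⁻¹) + (2 * H * ((-1 - 2 * H) * α ^ (-1 - 2 * H - 1))
        * fH H (α * τ) + 2 * H * α ^ (-1 - 2 * H) * (τ * deriv (fH H) (α * τ)))) α := by
    have a1 := (hasDerivAt_inv hα.ne').const_mul (2 * τ ^ (2 * H))
    have a2 := ((Real.hasDerivAt_rpow_const (p := -1 - 2 * H) (Or.inl hα.ne')).const_mul
      (2 * H)).mul (hasDerivAt_fH_mul_const h0 hα hτ)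
    simp only [div_eq_mul_inv]
    exact a1.add a2
  have heq : (fun lam => ∫ w in Set.Ioi (0 : ℝ), Real.exp (-lam * w) * G w) =ᶠ[𝓝 α]
      fun lam => 2 * τ ^ (2 * H) / lam + 2 * H * lam ^ (-1 - 2 * H) * fH H (lam * τ) := by
    filter_upwards [Ioi_mem_nhds hα] with lam hlam
    exact integral_exp_neg_mul_mul_abs_rpow h0 hlam hτ
  have huniq := hd.unique (hf.congr_of_eventuallyEq heq)
  rw [integral_neg] at huniq
  rw [show -2 - 2 * H = -1 - 2 * H - 1 by ring]
  linear_combination -huniq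

/-! ### Second moments, autocorrelations of the two kernels, and the theorem -/

/-- The second moments of a moving average of increments of a fractional Brownian motion with
kernel `h`, in terms of the autocorrelation `ρ` of `h`. -/
theorem IsFractionalBrownianMotion.movingAverage_secondMoment {Ω : Type*} [MeasurableSpace Ω]
    {P : Measure Ω} [IsProbabilityMeasure P] {B X : ℝ → Ω → ℝ} {H σ : ℝ}
    (hB : IsFractionalBrownianMotion B H P) {h ρ : ℝ → ℝ} (hhm : Measurable h)
    (hh : IntegrableOn (fun u => h u * (1 + u ^ 2)) (Set.Ioi 0))
    (hone : ∫ u in Set.Ioi (0 : ℝ), h u = 1)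
    (hρm : Measurable ρ) (hρi : IntegrableOn (fun u => ρ u * (1 + u ^ 2)) (Set.Ioi 0))
    (hρ : ∀ w, 0 ≤ w → ∫ v in Set.Ioi (0 : ℝ), h v * h (v + w) = ρ w)
    (hX : ∀ᵐ ω ∂P, ∀ t, X t ω =
      ∫ u in Set.Ioi (0 : ℝ), h u * (σ * B t ω - σ * B (t - u) ω)) (s t : ℝ) :
    Integrable (fun ω => X s ω * X (s + t) ω) P ∧
    ∫ ω, X s ω * X (s + t) ω ∂P = σ ^ 2 *
      (((∫ w in Set.Ioi (0 : ℝ), (h w - ρ w) * (|t - w| ^ (2 * H) + |t + w| ^ (2 * H)))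
        - |t| ^ (2 * H)) / 2) := by
  have hh' := integrableOn_abs_mul_one_add_sq hh
  -- The later time goes first, so the time difference is `t` and not `-t`.
  obtain ⟨hi, he⟩ := hB.integrable_and_integral_movingAverage hhm hh' (s + t) s
  rw [add_sub_cancel_left, integral_prod_incrementCov hB.hurst_pos hB.hurst_le_one t hhm hh' hone
    hρm (integrableOn_abs_mul_one_add_sq hρi) hρ] at he
  have hXX : ∀ᵐ ω ∂P, X s ω * X (s + t) ω = σ ^ 2 *
      ((∫ u in Set.Ioi (0 : ℝ), h u * (B (s + t) ω - B (s + t - u) ω)) *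
        ∫ v in Set.Ioi (0 : ℝ), h v * (B s ω - B (s - v) ω)) := by
    filter_upwards [hX] with ω hω
    have e : ∀ r, X r ω = σ * ∫ u in Set.Ioi (0 : ℝ), h u * (B r ω - B (r - u) ω) := by
      intro r
      rw [hω, ← integral_const_mul]
      congr 1
      ext u
      ring
    rw [e, e]
    ring
  refine ⟨(integrable_congr hXX).2 (hi.const_mul _), ?_⟩
  rw [integral_congr_ae hXX, integral_const_mul, he]

theorem integral_kernel_mul_shift_of_ne {α β : ℝ} (hα : 0 < α) (hβ : 0 < β) (w : ℝ) :
    ∫ v in Set.Ioi (0 : ℝ),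
      (α ^ 2 * Real.exp (-α * v) - β ^ 2 * Real.exp (-β * v)) / (α - β) *
        ((α ^ 2 * Real.exp (-α * (v + w)) - β ^ 2 * Real.exp (-β * (v + w))) / (α - β))
      = (α ^ 3 / 2 * Real.exp (-α * w)
          - α ^ 2 * β ^ 2 / (α + β) * (Real.exp (-α * w) + Real.exp (-β * w))
          + β ^ 3 / 2 * Real.exp (-β * w)) / (α - β) ^ 2 := by
  have hαβ : 0 < α + β := by linarith
  have e : ∀ v, (α ^ 2 * Real.exp (-α * v) - β ^ 2 * Real.exp (-β * v)) / (α - β) *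
        ((α ^ 2 * Real.exp (-α * (v + w)) - β ^ 2 * Real.exp (-β * (v + w))) / (α - β))
      = (α ^ 4 * Real.exp (-α * w) * Real.exp (-(2 * α) * v)
        - α ^ 2 * β ^ 2 * (Real.exp (-α * w) + Real.exp (-β * w)) * Real.exp (-(α + β) * v)
        + β ^ 4 * Real.exp (-β * w) * Real.exp (-(2 * β) * v)) / (α - β) ^ 2 := by
    intro v
    have e1 : Real.exp (-(2 * α) * v) = Real.exp (-α * v) * Real.exp (-α * v) := by
      rw [← Real.exp_add]; ring_nf
    have e2 : Real.exp (-(2 * β) * v) = Real.exp (-β * v) * Real.exp (-β * v) := by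
      rw [← Real.exp_add]; ring_nf
    have e3 : Real.exp (-(α + β) * v) = Real.exp (-α * v) * Real.exp (-β * v) := by
      rw [← Real.exp_add]; ring_nf
    rw [e1, e2, e3, mul_add (-α), mul_add (-β), Real.exp_add, Real.exp_add, div_mul_div_comm, ← sq]
    congr 1
    ring
  have i1 := (integrableOn_exp_neg_mul_Ioi_zero (by positivity : 0 < 2 * α)).const_mul
    (α ^ 4 * Real.exp (-α * w))
  have i2 := (integrableOn_exp_neg_mul_Ioi_zero hαβ).const_mul
    (α ^ 2 * β ^ 2 * (Real.exp (-α * w) + Real.exp (-β * w)))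
  have i3 := (integrableOn_exp_neg_mul_Ioi_zero (by positivity : 0 < 2 * β)).const_mul
    (β ^ 4 * Real.exp (-β * w))
  have i12 : Integrable (fun v => α ^ 4 * Real.exp (-α * w) * Real.exp (-(2 * α) * v)
        - α ^ 2 * β ^ 2 * (Real.exp (-α * w) + Real.exp (-β * w)) * Real.exp (-(α + β) * v))
      (volume.restrict (Set.Ioi 0)) := i1.sub i2
  simp only [e]
  rw [integral_div, integral_add i12 i3, integral_sub i1 i2, integral_const_mul,
    integral_const_mul, integral_const_mul, integral_exp_neg_mul_Ioi_zero (by positivity),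
    integral_exp_neg_mul_Ioi_zero hαβ, integral_exp_neg_mul_Ioi_zero (by positivity)]
  congr 1
  field_simp

theorem integral_kernel_mul_shift_of_eq {α : ℝ} (hα : 0 < α) (w : ℝ) :
    ∫ v in Set.Ioi (0 : ℝ),
      (2 * α * Real.exp (-α * v) - α ^ 2 * (v * Real.exp (-α * v))) *
        (2 * α * Real.exp (-α * (v + w)) - α ^ 2 * ((v + w) * Real.exp (-α * (v + w))))
      = 5 * α / 4 * Real.exp (-α * w) - 3 * α ^ 2 / 4 * (w * Real.exp (-α * w)) := by
  have h2 : 0 < 2 * α := by positivity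
  have e : ∀ v, (2 * α * Real.exp (-α * v) - α ^ 2 * (v * Real.exp (-α * v))) *
        (2 * α * Real.exp (-α * (v + w)) - α ^ 2 * ((v + w) * Real.exp (-α * (v + w))))
      = (4 * α ^ 2 - 2 * α ^ 3 * w) * Real.exp (-α * w) * Real.exp (-(2 * α) * v)
        + (α ^ 4 * w - 4 * α ^ 3) * Real.exp (-α * w) * (v ^ 1 * Real.exp (-(2 * α) * v))
        + α ^ 4 * Real.exp (-α * w) * (v ^ 2 * Real.exp (-(2 * α) * v)) := by
    intro v
    have e1 : Real.exp (-(2 * α) * v) = Real.exp (-α * v) * Real.exp (-α * v) := by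
      rw [← Real.exp_add]; ring_nf
    rw [e1, mul_add (-α), Real.exp_add]
    ring
  have i1 := (integrableOn_exp_neg_mul_Ioi_zero h2).const_mul
    ((4 * α ^ 2 - 2 * α ^ 3 * w) * Real.exp (-α * w))
  have i2 := (integrableOn_pow_mul_exp_neg_mul_Ioi h2 1).const_mul
    ((α ^ 4 * w - 4 * α ^ 3) * Real.exp (-α * w))
  have i3 := (integrableOn_pow_mul_exp_neg_mul_Ioi h2 2).const_mul
    (α ^ 4 * Real.exp (-α * w))
  have i12 : Integrable (fun v =>
      (4 * α ^ 2 - 2 * α ^ 3 * w) * Real.exp (-α * w) * Real.exp (-(2 * α) * v)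
        + (α ^ 4 * w - 4 * α ^ 3) * Real.exp (-α * w) * (v ^ 1 * Real.exp (-(2 * α) * v)))
      (volume.restrict (Set.Ioi 0)) := i1.add i2
  simp only [e]
  rw [integral_add i12 i3, integral_add i1 i2, integral_const_mul,
    integral_const_mul, integral_const_mul, integral_exp_neg_mul_Ioi_zero h2,
    integral_pow_mul_exp_neg_mul_Ioi h2, integral_pow_mul_exp_neg_mul_Ioi h2]
  norm_num
  field_simp
  ring

theorem IsFOU.exists_of_ne {Ω : Type*} [MeasurableSpace Ω] {P : Measure Ω}
    [IsProbabilityMeasure P] {X : ℝ → Ω → ℝ} {α β σ H : ℝ}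
    (hX : IsFOU X [(α, 1), (β, 1)] σ H P) (hne : α ≠ β) :
    0 < α ∧ 0 < β ∧ ∃ B, IsFractionalBrownianMotion B H P ∧ ∀ᵐ ω ∂P, ∀ t, X t ω =
      ∫ u in Set.Ioi (0 : ℝ),
        (α ^ 2 * Real.exp (-α * u) - β ^ 2 * Real.exp (-β * u)) / (α - β) *
          (σ * B t ω - σ * B (t - u) ω) := by
  have hα : 0 < α := hX.pos (α, 1) (by simp)
  have hβ : 0 < β := hX.pos (β, 1) (by simp)
  obtain ⟨B, hB, hXB⟩ := hX.exists_fbm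
  refine ⟨hα, hβ, B, hB, ?_⟩
  -- One weight strictly below both rates serves for both integrals.
  obtain ⟨γ, hγ, hγm⟩ := exists_between (lt_min hα hβ)
  filter_upwards [hXB, hB.continuous_paths, hB.ae_integrableOn_exp_mul hγ] with ω h1 h2 h3 t
  refine HasIteratedOUValue.eq_integral_of_ne (y := fun s => σ * B s ω) hγ
    (hγm.trans_le (min_le_left _ _)) (hγm.trans_le (min_le_right _ _)) hne
    (continuous_const.mul h2) ?_ (h1 t)
  simp only [mul_left_comm _ σ]
  exact Integrable.const_mul h3 σ

theorem IsFOU.exists_of_eq {Ω : Type*} [MeasurableSpace Ω] {P : Measure Ω}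
    [IsProbabilityMeasure P] {X : ℝ → Ω → ℝ} {α σ H : ℝ} (hX : IsFOU X [(α, 2)] σ H P) :
    0 < α ∧ ∃ B, IsFractionalBrownianMotion B H P ∧ ∀ᵐ ω ∂P, ∀ t, X t ω =
      ∫ u in Set.Ioi (0 : ℝ),
        (2 * α * Real.exp (-α * u) - α ^ 2 * (u * Real.exp (-α * u))) *
          (σ * B t ω - σ * B (t - u) ω) := by
  have hα : 0 < α := hX.pos (α, 2) (by simp)
  obtain ⟨B, hB, hXB⟩ := hX.exists_fbm
  refine ⟨hα, B, hB, ?_⟩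
  obtain ⟨γ, hγ, hγm⟩ := exists_between hα
  filter_upwards [hXB, hB.continuous_paths, hB.ae_integrableOn_exp_mul hγ] with ω h1 h2 h3 t
  refine HasIteratedOUValue.eq_integral_of_eq (y := fun s => σ * B s ω) hγ hγm
    (continuous_const.mul h2) ?_ (h1 t)
  simp only [mul_left_comm _ σ]
  exact Integrable.const_mul h3 σ

theorem proposition1 {Ω : Type*} [MeasurableSpace Ω] (P : Measure Ω) [IsProbabilityMeasure P]
    (X : ℝ → Ω → ℝ) (σ H : ℝ) :
    (∀ α β : ℝ, α ≠ β → IsFOU X [(α, 1), (β, 1)] σ H P →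
      ∀ s t : ℝ, 0 ≤ t →
        Integrable (fun ω => X s ω * X (s + t) ω) P ∧
        ∫ ω, X s ω * X (s + t) ω ∂P =
          σ ^ 2 * H / 2 *
            ((α ^ (2 - 2 * H) * fH H (α * t) - β ^ (2 - 2 * H) * fH H (β * t)) /
              (α ^ 2 - β ^ 2))) ∧
    (∀ α : ℝ, IsFOU X [(α, 2)] σ H P →
      ∀ s t : ℝ, 0 ≤ t →
        Integrable (fun ω => X s ω * X (s + t) ω) P ∧
        (0 < t → DifferentiableAt ℝ (fH H) (α * t)) ∧
        ∫ ω, X s ω * X (s + t) ω ∂P =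
          σ ^ 2 * H / (2 * α ^ (2 * H)) *
            ((1 - H) * fH H (α * t) + α * t * deriv (fH H) (α * t) / 2)) := by
  refine ⟨fun α β hne hX s t ht => ?_, fun α hX s t ht => ?_⟩
  · obtain ⟨hα, hβ, B, hB, hXB⟩ := hX.exists_of_ne hne
    have h0 := hB.hurst_pos
    have kα := integrableOn_pow_mul_exp_neg_mul_one_add_sq hα 0
    have kβ := integrableOn_pow_mul_exp_neg_mul_one_add_sq hβ 0
    have gα := integrableOn_pow_mul_exp_neg_mul_abs_rpow h0 hB.hurst_le_one hα t 0
    have gβ := integrableOn_pow_mul_exp_neg_mul_abs_rpow h0 hB.hurst_le_one hβ t 0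
    simp only [pow_zero, one_mul] at kα kβ gα gβ
    have kαβ : ∀ a b : ℝ, IntegrableOn (fun u => a * (Real.exp (-α * u) * (1 + u ^ 2))
        + b * (Real.exp (-β * u) * (1 + u ^ 2))) (Set.Ioi 0) := fun a b =>
      (kα.const_mul a).add (kβ.const_mul b)
    obtain ⟨hint, heq⟩ := hB.movingAverage_secondMoment (h := fun u =>
        (α ^ 2 * Real.exp (-α * u) - β ^ 2 * Real.exp (-β * u)) / (α - β)) (by fun_prop)
      ((kαβ (α ^ 2 / (α - β)) (-(β ^ 2 / (α - β)))).congr_fun (fun u _ => by ring)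
        measurableSet_Ioi)
      (integral_kernel_of_ne hα hβ hne) (by fun_prop)
      ((kαβ ((α ^ 3 / 2 - α ^ 2 * β ^ 2 / (α + β)) / (α - β) ^ 2)
        ((β ^ 3 / 2 - α ^ 2 * β ^ 2 / (α + β)) / (α - β) ^ 2)).congr_fun (fun u _ => by ring)
        measurableSet_Ioi)
      (fun w _ => integral_kernel_mul_shift_of_ne hα hβ w) hXB s t
    refine ⟨hint, heq.trans ?_⟩
    have hs : α - β ≠ 0 := sub_ne_zero.2 hne
    have hp : α + β ≠ 0 := by positivity
    have hsq : α ^ 2 - β ^ 2 ≠ 0 := by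
      rw [sq_sub_sq]; exact mul_ne_zero hp hs
    -- In `h - ρ` the contributions with denominator `α + β` recombine into a difference of two
    -- exponentials. Against the terms `2 t^{2H} / α` and `2 t^{2H} / β` its coefficients give
    -- exactly `t^{2H}`, which cancels `-|t|^{2H}`.
    have e : ∀ w, ((α ^ 2 * Real.exp (-α * w) - β ^ 2 * Real.exp (-β * w)) / (α - β)
        - (α ^ 3 / 2 * Real.exp (-α * w)
          - α ^ 2 * β ^ 2 / (α + β) * (Real.exp (-α * w) + Real.exp (-β * w))
          + β ^ 3 / 2 * Real.exp (-β * w)) / (α - β) ^ 2)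
          * (|t - w| ^ (2 * H) + |t + w| ^ (2 * H))
        = α ^ 3 / (2 * (α ^ 2 - β ^ 2)) *
            (Real.exp (-α * w) * (|t - w| ^ (2 * H) + |t + w| ^ (2 * H)))
          - β ^ 3 / (2 * (α ^ 2 - β ^ 2)) *
            (Real.exp (-β * w) * (|t - w| ^ (2 * H) + |t + w| ^ (2 * H))) := by
      intro w
      rw [sq_sub_sq]
      field_simp
      ring
    simp only [e]
    rw [integral_sub (gα.const_mul _) (gβ.const_mul _), integral_const_mul, integral_const_mul,
      integral_exp_neg_mul_mul_abs_rpow h0 hα ht, integral_exp_neg_mul_mul_abs_rpow h0 hβ ht,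
      abs_of_nonneg ht]
    have hpow : ∀ c : ℝ, 0 < c → c ^ (2 - 2 * H) = c ^ 3 * c ^ (-1 - 2 * H) := fun c hc => by
      rw [← Real.rpow_natCast c 3, ← Real.rpow_add hc]
      norm_num
      ring_nf
    rw [hpow α hα, hpow β hβ]
    field_simp
    ring
  · obtain ⟨hα, B, hB, hXB⟩ := hX.exists_of_eq
    have h0 := hB.hurst_pos
    have k0 := integrableOn_pow_mul_exp_neg_mul_one_add_sq hα 0
    have k1 := integrableOn_pow_mul_exp_neg_mul_one_add_sq hα 1
    have g0 := integrableOn_pow_mul_exp_neg_mul_abs_rpow h0 hB.hurst_le_one hα t 0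
    have g1 := integrableOn_pow_mul_exp_neg_mul_abs_rpow h0 hB.hurst_le_one hα t 1
    simp only [pow_zero, pow_one, one_mul] at k0 k1 g0 g1
    have k01 : ∀ a b : ℝ, IntegrableOn (fun u => a * (Real.exp (-α * u) * (1 + u ^ 2))
        + b * (u * Real.exp (-α * u) * (1 + u ^ 2))) (Set.Ioi 0) := fun a b =>
      (k0.const_mul a).add (k1.const_mul b)
    obtain ⟨hint, heq⟩ := hB.movingAverage_secondMoment (h := fun u =>
        2 * α * Real.exp (-α * u) - α ^ 2 * (u * Real.exp (-α * u))) (by fun_prop)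
      ((k01 (2 * α) (-α ^ 2)).congr_fun (fun u _ => by ring) measurableSet_Ioi)
      (integral_kernel_of_eq hα) (by fun_prop)
      ((k01 (5 * α / 4) (-(3 * α ^ 2 / 4))).congr_fun (fun u _ => by ring) measurableSet_Ioi)
      (fun w _ => integral_kernel_mul_shift_of_eq hα w) hXB s t
    refine ⟨hint, fun ht => differentiableAt_fH h0 (mul_pos hα ht), heq.trans ?_⟩
    -- Here `3/2 - 1/2 = 1` cancels `-|t|^{2H}`, and `3/4 - (1 + 2H)/4 = (1 - H)/2` is the source of
    -- the factor `1 - H`.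
    have e : ∀ w, (2 * α * Real.exp (-α * w) - α ^ 2 * (w * Real.exp (-α * w))
        - (5 * α / 4 * Real.exp (-α * w) - 3 * α ^ 2 / 4 * (w * Real.exp (-α * w))))
          * (|t - w| ^ (2 * H) + |t + w| ^ (2 * H))
        = 3 * α / 4 * (Real.exp (-α * w) * (|t - w| ^ (2 * H) + |t + w| ^ (2 * H)))
          - α ^ 2 / 4 *
            (w * Real.exp (-α * w) * (|t - w| ^ (2 * H) + |t + w| ^ (2 * H))) := fun w => by
      ring
    simp only [e]
    rw [integral_sub (g0.const_mul _) (g1.const_mul _), integral_const_mul, integral_const_mul,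
      integral_exp_neg_mul_mul_abs_rpow h0 hα ht,
      integral_mul_exp_neg_mul_mul_abs_rpow h0 hB.hurst_le_one hα ht, abs_of_nonneg ht]
    have hl : 0 < α ^ (2 * H) := Real.rpow_pos_of_pos hα _
    have e1 : α ^ (-1 - 2 * H) = α⁻¹ * (α ^ (2 * H))⁻¹ := by
      rw [sub_eq_add_neg, Real.rpow_add hα, Real.rpow_neg_one, Real.rpow_neg hα.le]
    have e2 : α ^ (-2 - 2 * H) = (α ^ 2)⁻¹ * (α ^ (2 * H))⁻¹ := by
      rw [sub_eq_add_neg, Real.rpow_add hα, Real.rpow_neg hα.le, Real.rpow_neg hα.le,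
        Real.rpow_two]
    rw [e1, e2]
    field_simp
    ring
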